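/- Let $G=(V,E)$ be a finite directed graph (self-loops allowed) with $n$ vertices and $m$ edges, and let $(L_i,U_i)$, $1\le i\le k$, be pairs of subsets of $V$. The Streett objective is the set of infinite paths $\pi$ of $G$ such that for every $i$, either no vertex of $L_i$ or some vertex of $U_i$ occurs infinitely often on $\pi$. Its winning set is the set of vertices from which an infinite path in the objective starts. A symbolic algorithm accesses $E$ only through $\mathrm{Pre}(Z)=\{v:\exists w\in Z,\ (v,w)\in E\}$ and $\mathrm{Post}(Z)=\{v:\exists w\in Z,\ (w,v)\in E\}$; each application of $\mathrm{Pre}$ or $\mathrm{Post}$ is one symbolic step. Set operations, cardinalities and picking an arbitrary element are free. For $S\subseteq V$ let $\mathrm{Bad}(S)=\bigcup_{i:\,U_i\cap S=\emptyset}(L_i\cap S)$. **Algorithm StreettGraphImpr.** Keep a set $\mathcal X$ of candidates $(S,H,T)$ with $H,T\subseteq S\subseteq V$, initially $(C,\emptyset,\emptyset)$ for all strongly connected components (SCCs) $C$ of $G$, and a set $\mathcal G$ of vertex sets, initially empty. While $\mathcal X\ne\emptyset$, remove an arbitrary $(S,H,T)$ from $\mathcal X$ and do the following. 1. While $B:=\mathrm{Bad}(S)\neq\emptyset$: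 replace $S$ by $S\setminus B$, then $H$ by $(H\cup\mathrm{Post}(B))\cap S$ and $T$ by $(T\cup\mathrm{Pre}(B))\cap S$. 2. If $\mathrm{Post}(S)\cap S=\emptyset$, discard $S$. Otherwise: - if $|H|+|T|=0$, add $S$ to $\mathcal G$; - else if $|H|+|T|\ge\sqrt{m/\log n}$, compute the SCCs of the induced subgraph $G[S]$; if there is only one, add $S$ to $\mathcal G$, otherwise add $(C,\emptyset,\emptyset)$ to $\mathcal X$ for each of these SCCs $C$; - else run lock-step search on $(S,H,T)$, which returns $(C,H',T')$; if $C=S$, add $S$ to $\mathcal G$; otherwise let $S'=S\setminus C$ and add to $\mathcal X$ the candidates $(C,\emptyset,\emptyset)$ and $(S',(H'\cup\mathrm{Post}(C))\cap S',(T'\cup\mathrm{Pre}(C))\cap S')$. When $\mathcal X=\emptyset$, return the set of vertices that can reach $\bigcup\mathcal G$, computed by iterating $\mathrm{Pre}$. *SCCs* are computed by the linear skeleton-based symbolic algorithm of Gentilini, Piazza and Policriti. *Lock-step search* on $(S,H,T)$ keeps a set $C_h$, initially $\{h\}$, for each $h\in H$ (backward searches) and, separately, a set $C_t$, initially $\{t\}$,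 for each $t\in T$ (forward searches). It repeats rounds. In a round, $H'$ and $T'$ start as copies of $H$ and $T$. First, for each $h\in H$, in any order, let $C'=(C_h\cup\mathrm{Pre}(C_h))\cap S$: if $|C'\cap H'|>1$, remove $h$ from $H'$; else if $C'=C_h$, stop and return $(C_h,H',T)$; else set $C_h:=C'$. Then, for each $t\in T$, in any order, let $C'=(C_t\cup\mathrm{Post}(C_t))\cap S$: if $|C'\cap T'|>1$, remove $t$ from $T'$; else if $C'=C_t$, stop and return $(C_t,H',T')$; else set $C_t:=C'$. At the end of the round, $H:=H'$ and $T:=T'$. **Theorem.** There is a universal constant $c>0$ such that for all $G$ and all pairs $(L_i,U_i)_{1\le i\le k}$, and however the arbitrary choices are made, the algorithm terminates and returns exactly the winning set of the Streett objective. If moreover $n\ge2$ and $m\ge1$, it uses at most $c\cdot n\sqrt{m\log n}$ symbolic steps. -/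

import Mathlib

universe u

/-! ## Symbolic programs

A symbolic program works with vertex sets and has no access to the edges of the graph except
through the one-step operators `Pre` and `Post`.  The programs below are independent of the
graph; the graph enters only in their semantics. -/

/-- Symbolic programs over the vertex set `V` that return a value of type `α`.

* `ret a` returns `a`;
* `bind p f` runs `p` and passes its value to `f`;
* `pre Z` and `post Z` return `Pre(Z)` and `Post(Z)`;
* `choose Z` returns an arbitrary element of the finite set `Z`;
* `loop body s` starts with the state `s` and repeats `body`, which returns either a new state
  `Sum.inl s'` (the loop goes on) or a result `Sum.inr a` (the loop ends with the result `a`).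

Set operations and cardinalities are ordinary functions on values. -/
inductive SymProg (V : Type u) : Type u → Type (u + 1)
  | ret {α : Type u} (a : α) : SymProg V α
  | bind {α β : Type u} (p : SymProg V β) (f : β → SymProg V α) : SymProg V α
  | pre (Z : Finset V) : SymProg V (Finset V)
  | post (Z : Finset V) : SymProg V (Finset V)
  | choose {α : Type u} (Z : Finset α) : SymProg V α
  | loop {σ α : Type u} (body : σ → SymProg V (σ ⊕ α)) (s : σ) : SymProg V α

namespace SymProg

instance (V : Type u) : Monad (SymProg V) where
  pure := SymProg.ret
  bind := SymProg.bind

/-- The terminating runs of a loop, where `run s x t` says that the body can take the state `s`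
to `x` in `t` symbolic steps. -/
inductive LoopExec {σ α : Type u} (run : σ → σ ⊕ α → ℕ → Prop) : σ → α → ℕ → Prop
  | done {s : σ} {a : α} {t : ℕ} : run s (Sum.inr a) t → LoopExec run s a t
  | step {s s' : σ} {a : α} {t t' : ℕ} :
      run s (Sum.inl s') t → LoopExec run s' a t' → LoopExec run s a (t + t')

/-- All runs of a loop terminate, where `ok s` says that all runs of the body from the state `s`
terminate, and `run` is as in `LoopExec`. -/
inductive LoopHalts {σ α : Type u} (ok : σ → Prop) (run : σ → σ ⊕ α → ℕ → Prop) : σ → Prop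
  | intro {s : σ} : ok s →
      (∀ (s' : σ) (t : ℕ), run s (Sum.inl s') t → LoopHalts ok run s') → LoopHalts ok run s

end SymProg

/-- `Pre(Z)`: the vertices with an edge into `Z`. -/
def Digraph.preSet {V : Type u} [Fintype V] (G : Digraph V) [DecidableRel G.Adj]
    (Z : Finset V) : Finset V :=
  {v : V | ∃ w ∈ Z, G.Adj v w}

/-- `Post(Z)`: the vertices with an edge from `Z`. -/
def Digraph.postSet {V : Type u} [Fintype V] (G : Digraph V) [DecidableRel G.Adj]
    (Z : Finset V) : Finset V :=
  {v : V | ∃ w ∈ Z, G.Adj w v}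

/-- The number `m` of edges (self-loops included). -/
def Digraph.numEdges {V : Type u} [Fintype V] (G : Digraph V) [DecidableRel G.Adj] : ℕ :=
  (Finset.univ.filter fun e : V × V => G.Adj e.1 e.2).card

namespace SymProg

section Semantics

variable {V : Type u} [Fintype V] (G : Digraph V) [DecidableRel G.Adj]

/-- `p.Exec G a t`: on the graph `G`, the program `p` has a terminating run that returns `a` and
uses exactly `t` symbolic steps, that is, executes exactly `t` of the operations `Pre` and
`Post`. -/
def Exec {α : Type u} : SymProg V α → α → ℕ → Prop
  | .ret a, b, t => b = a ∧ t = 0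
  | .bind p f, b, t => ∃ a t₁ t₂, Exec p a t₁ ∧ Exec (f a) b t₂ ∧ t = t₁ + t₂
  | .pre Z, b, t => b = G.preSet Z ∧ t = 1
  | .post Z, b, t => b = G.postSet Z ∧ t = 1
  | .choose Z, b, t => b ∈ Z ∧ t = 0
  | .loop body s, b, t => LoopExec (fun s x t => Exec (body s) x t) s b t

/-- `p.Halts G`: on the graph `G`, every run of `p` terminates and never tries to choose an
element of the empty set, however the choices are made. -/
def Halts {α : Type u} : SymProg V α → Prop
  | .ret _ => True
  | .bind p f => Halts p ∧ ∀ a t, p.Exec G a t → Halts (f a)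
  | .pre _ => True
  | .post _ => True
  | .choose Z => Z.Nonempty
  | .loop body s =>
      LoopHalts (fun s => Halts (body s)) (fun s x t => (body s).Exec G x t) s

end Semantics

/-- Run `f b` for all `b ∈ Z`, one after the other in an arbitrary order, and thread a state.
`f` returns either the new state `Sum.inl s'`, or `Sum.inr a`, which leaves the loop early.
The result is `Sum.inl s` if the loop ran to its end, and `Sum.inr a` if it was left early. -/
def forEach {V β σ α : Type u} [DecidableEq β] (Z : Finset β) (s : σ)
    (f : β → σ → SymProg V (σ ⊕ α)) : SymProg V (σ ⊕ α) :=
  loop (fun (Rs : Finset β × σ) =>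
    if Rs.1 = ∅ then return Sum.inr (Sum.inl Rs.2)
    else do
      let b ← choose Rs.1
      match ← f b Rs.2 with
      | Sum.inl s' => return Sum.inl (Rs.1.erase b, s')
      | Sum.inr a => return Sum.inr (Sum.inr a)) (Z, s)

end SymProg

open SymProg in
/-- Backward reachability: the vertices that can reach a vertex of `Z`. -/
def symReach {V : Type u} [DecidableEq V] (Z : Finset V) : SymProg V (Finset V) :=
  loop (fun R : Finset V => do
    let P ← pre R
    if P ⊆ R then return Sum.inr R else return Sum.inl (R ∪ P)) Z

/-! ## Symbolic computation of the strongly connected components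

The linear skeleton-based algorithm of Gentilini, Piazza and Policriti. -/

open SymProg in
/-- Breadth-first layers, within `A`, of the forward search from `N`.  It returns the forward set
of `N` in `A`, and the list of the layers, the last layer first. -/
def forwardLayers {V : Type u} [DecidableEq V] (A N : Finset V) :
    SymProg V (Finset V × List (Finset V)) :=
  loop (fun (st : Finset V × Finset V × List (Finset V)) =>
    let (L, FW, stack) := st
    if L = ∅ then return Sum.inr (FW, stack)
    else do
      let P ← post L
      return Sum.inl ((P ∩ A) \ (FW ∪ L), FW ∪ L, L :: stack)) (N, ∅, [])

open SymProg in
/-- The forward set `FW` of `N` within `A`, with a skeleton of it: `newN` consists of one vertex of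
the last layer, and `newS` of the vertices of a shortest path from `N` to this vertex.  It returns
`(FW, newS, newN)`. -/
def skelForward {V : Type u} [DecidableEq V] (A N : Finset V) :
    SymProg V (Finset V × Finset V × Finset V) := do
  let (FW, stack) ← forwardLayers A N
  match stack with
  | [] => return (FW, ∅, ∅)
  | L :: rest =>
    let v ← choose L
    let newS ← loop (fun (st : List (Finset V) × Finset V) =>
      match st.1 with
      | [] => return Sum.inr st.2
      | L' :: rest' => do
        let P ← pre st.2
        let w ← choose (P ∩ L')
        return Sum.inl (rest', insert w st.2)) (rest, {v})
    return (FW, newS, {v})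

open SymProg in
/-- `allSCCs A` returns the set of all strongly connected components of the subgraph induced by
`A`.  The list `todo` is the stack of the pending recursive calls `(A, S, N)`: compute the
components of the subgraph induced by `A`, where `S` is the vertex set of a path, used as a guide,
and `N` consists of its last vertex (both are empty if there is no guide). -/
def allSCCs {V : Type u} [DecidableEq V] (A : Finset V) : SymProg V (Finset (Finset V)) :=
  loop (fun (st : List (Finset V × Finset V × Finset V) × Finset (Finset V)) =>
    match st with
    | ([], sccs) => return Sum.inr sccs
    | ((A, S, N) :: todo, sccs) =>
      if A = ∅ then return Sum.inl (todo, sccs)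
      else do
        let N ← (if S = ∅ then choose A >>= fun v => pure {v} else pure N)
        let (FW, newS, newN) ← skelForward A N
        let scc ← loop (fun R : Finset V => do
          let P ← pre R
          if P ∩ FW ⊆ R then return Sum.inr R else return Sum.inl (R ∪ (P ∩ FW))) N
        let P ← pre (scc ∩ S)
        return Sum.inl
          ((A \ FW, S \ scc, P ∩ (S \ scc)) :: (FW \ scc, newS \ scc, newN \ scc) :: todo,
            insert scc sccs)) ([(A, ∅, ∅)], ∅)

/-! ## Lock-step search -/

open SymProg in
/-- Lock-step search in the subgraph induced by `S`, backwards from the vertices of `H` and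
forwards from the vertices of `T`.  The set `CH h` holds what the backward search from `h ∈ H` has
reached, and `CT t` what the forward search from `t ∈ T` has reached.  It returns the set that was
found and the updated sets of start vertices. -/
def lockStepSearch {V : Type u} [DecidableEq V] (S H T : Finset V) :
    SymProg V (Finset V × Finset V × Finset V) :=
  loop (fun (st : Finset V × Finset V × (V → Finset V) × (V → Finset V)) => do
    let (H, T, CH, CT) := st
    let rH ← forEach H (H, CH) (fun h (s : Finset V × (V → Finset V)) => do
      let (H', CH) := s
      let P ← pre (CH h)
      let C' := (CH h ∪ P) ∩ S
      if 1 < (C' ∩ H').card then return Sum.inl (H'.erase h, CH)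
      else if C' = CH h then return Sum.inr (CH h, H', T)
      else return Sum.inl (H', Function.update CH h C'))
    match rH with
    | Sum.inr res => return Sum.inr res
    | Sum.inl (H', CH) => do
      let rT ← forEach T (T, CT) (fun t (s : Finset V × (V → Finset V)) => do
        let (T', CT) := s
        let P ← post (CT t)
        let C' := (CT t ∪ P) ∩ S
        if 1 < (C' ∩ T').card then return Sum.inl (T'.erase t, CT)
        else if C' = CT t then return Sum.inr (CT t, H', T')
        else return Sum.inl (T', Function.update CT t C'))
      match rT with
      | Sum.inr res => return Sum.inr res
      | Sum.inl (T', CT) => return Sum.inl (H', T', CH, CT))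
    (H, T, (fun v => {v}), (fun v => {v}))

/-! ## Streett objectives -/

/-- The vertices that occur infinitely often in the sequence `π`. -/
def infOcc {V : Type u} (π : ℕ → V) : Set V := {v | ∀ i, ∃ j, i ≤ j ∧ π j = v}

/-- The plays (infinite paths) of `G`. -/
def Digraph.IsPlay {V : Type u} (G : Digraph V) (π : ℕ → V) : Prop :=
  ∀ i, G.Adj (π i) (π (i + 1))

/-- The Streett objective of the pairs `(L i, U i)`: the set of the plays of `G` such that for each
`i`, if a vertex of `L i` occurs infinitely often, then so does a vertex of `U i`. -/
def streettObjective {V : Type u} (G : Digraph V) {k : ℕ} (L U : Fin k → Finset V) :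
    Set (ℕ → V) :=
  {π | G.IsPlay π ∧
    ∀ i, (L i : Set V) ∩ infOcc π = ∅ ∨ ((U i : Set V) ∩ infOcc π).Nonempty}

/-- The winning set of an objective `φ`: the vertices from which there is a play in `φ`. -/
def winningSet {V : Type u} (φ : Set (ℕ → V)) : Set V := {v | ∃ π ∈ φ, π 0 = v}

/-- The bad vertices of `S`: the vertices of `L i ∩ S` for those `i` with `U i ∩ S = ∅`. -/
def badVertices {V : Type u} [DecidableEq V] {k : ℕ} (L U : Fin k → Finset V) (S : Finset V) :
    Finset V :=
  (Finset.univ.filter fun i => U i ∩ S = ∅).biUnion fun i => L i ∩ S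

open SymProg in
/-- Repeated removal of the bad vertices from the candidate `(S, H, T)`. -/
def removeBad {V : Type u} [DecidableEq V] {k : ℕ} (L U : Fin k → Finset V)
    (c : Finset V × Finset V × Finset V) : SymProg V (Finset V × Finset V × Finset V) :=
  loop (fun (st : Finset V × Finset V × Finset V) =>
    let (S, H, T) := st
    let B := badVertices L U S
    if B = ∅ then return Sum.inr (S, H, T)
    else do
      let S := S \ B
      let P ← post B
      let Q ← pre B
      return Sum.inl (S, (H ∪ P) ∩ S, (T ∪ Q) ∩ S)) c

open SymProg in
/-- Algorithm StreettGraphImpr for the pairs `(L i, U i)`; the number `m` of edges and the number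
`n` of vertices are used only in the threshold `√(m / log n)`.  In the loop, `X` is the set of the
candidates `(S, H_S, T_S)`, and `good` the set of the good components that have been found. -/
noncomputable def streettGraphImpr {V : Type u} [Fintype V] [DecidableEq V] {k : ℕ} (m : ℕ)
    (L U : Fin k → Finset V) : SymProg V (Finset V) := do
  let init ← allSCCs (Finset.univ : Finset V)
  let good ← loop
    (fun (st : Finset (Finset V × Finset V × Finset V) × Finset (Finset V)) => do
      let (X, good) := st
      if X = ∅ then return Sum.inr good
      else do
        let c ← choose X
        let X := X.erase c
        let (S, H, T) ← removeBad L U c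
        let P ← post S
        if P ∩ S = ∅ then return Sum.inl (X, good)
        else if H.card + T.card = 0 then return Sum.inl (X, insert S good)
        else if √((m : ℝ) / Real.log (Fintype.card V)) ≤ (H.card : ℝ) + (T.card : ℝ) then do
          let sccs ← allSCCs S
          if sccs.card = 1 then return Sum.inl (X, insert S good)
          else return Sum.inl (X ∪ sccs.image (fun C => (C, ∅, ∅)), good)
        else do
          let (C, H, T) ← lockStepSearch S H T
          if C = S then return Sum.inl (X, insert S good)
          else do
            let S := S \ C
            let P ← post C
            let Q ← pre C
            return Sum.inl (X ∪ {(S, (H ∪ P) ∩ S, (T ∪ Q) ∩ S)} ∪ {(C, ∅, ∅)}, good))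
    (init.image (fun C => (C, ∅, ∅)), ∅)
  symReach (good.biUnion id)

/-! Correctness. Call a strongly connected set good if it contains an edge and has no bad vertices.
The vertices seen infinitely often on a winning play form a good set, and a play that cycles through
a good set wins, so the winners are the vertices that reach a good set (`IsClosure.eq_winningSet`).
The main loop maintains that every good set lies in a candidate or in a component already found.
Deleting `Bad(S)` preserves this because a vertex bad in `S` is bad in every subset containing it.
Splitting along a set closed under predecessors or under successors preserves it because a strongly
connected set is never cut by such a set (`StronglyConn.subset_or_disjoint`).

Strong connectivity is expressed by closed sets: no proper nonempty subset contains all its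
predecessors. A candidate is either strongly connected with empty `H` and `T`, or `H` meets every
nonempty predecessor-closed subset and `T` every nonempty successor-closed one. So some backward
search from `H` stays inside any source component and some forward search from `T` inside any sink
component. If lock-step search finds `C ≠ S`, closed in one direction, then `S \ C` is closed in the
other and contains a search of the opposite kind. All surviving searches grow in every round, so the
number of rounds is at most the smaller of `|C|` and `|S \ C|` (`sat_lockStepSearch`).

Step count. Write `thr` for the threshold and let a candidate carry the potential `3(2|S| - 1) +
β(edges in S + |H| + |T|) + thr · |S|(1 + log₂ |S|)`. The first term pays for the single operations.
In the second, a new element of `H` or `T` is paid for by an edge that is cut (`candWeight_split`);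
when `|H| + |T| ≥ thr`, dropping `H` and `T` frees at least `β · thr ≥ 6n`, the price of a component
computation (`sat_allSCCs`). The third pays for lock-step search: at most `thr` steps per round, and
as many rounds as the smaller part has vertices (`splitPotential_add`). Taking `β = 6n / thr`
balances `β · m` against `thr · n log n`, both of order `n√(m log n)` (`steps_bound`). -/

open SymProg

/-! ### Program logic for total correctness with step counts -/

namespace SymProg

section TotalCorrectness

variable {V : Type u} [Fintype V] {G : Digraph V} [DecidableRel G.Adj]

/-- Total correctness: on the graph `G` all runs of `p` terminate, and each run that returns `a`
after `t` symbolic steps satisfies `Q a t`. -/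
def Sat (G : Digraph V) [DecidableRel G.Adj] {α : Type u} (p : SymProg V α)
    (Q : α → ℕ → Prop) : Prop :=
  p.Halts G ∧ ∀ a t, p.Exec G a t → Q a t

theorem Sat.mono {α : Type u} {p : SymProg V α} {Q Q' : α → ℕ → Prop} (h : Sat G p Q)
    (hQ : ∀ a t, Q a t → Q' a t) : Sat G p Q' :=
  ⟨h.1, fun a t e => hQ a t (h.2 a t e)⟩

theorem sat_pure {α : Type u} {a : α} {Q : α → ℕ → Prop} (h : Q a 0) :
    Sat G (pure a : SymProg V α) Q := by
  refine ⟨?_, ?_⟩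
  · change Halts G (ret a)
    simp [Halts]
  · intro b t e
    change Exec G (ret a) b t at e
    simp only [Exec] at e
    obtain ⟨rfl, rfl⟩ := e
    exact h

/-- The postcondition of `p` is the total correctness of its continuation, so a proof follows the
program operation by operation while the count accumulates in `t + t'`. -/
theorem sat_bind {α β : Type u} {p : SymProg V β} {f : β → SymProg V α} {Q : α → ℕ → Prop}
    (h : Sat G p fun a t => Sat G (f a) fun b t' => Q b (t + t')) : Sat G (p >>= f) Q := by
  refine ⟨?_, ?_⟩
  · change Halts G (bind p f)
    simp only [Halts]
    exact ⟨h.1, fun a t e => (h.2 a t e).1⟩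
  · intro b t e
    change Exec G (bind p f) b t at e
    simp only [Exec] at e
    obtain ⟨a, t₁, t₂, e₁, e₂, rfl⟩ := e
    exact (h.2 a t₁ e₁).2 b t₂ e₂

theorem sat_pre {Z : Finset V} {Q : Finset V → ℕ → Prop} (h : Q (G.preSet Z) 1) :
    Sat G (pre Z) Q := by
  refine ⟨by simp [Halts], ?_⟩
  intro b t e
  simp only [Exec] at e
  obtain ⟨rfl, rfl⟩ := e
  exact h

theorem sat_post {Z : Finset V} {Q : Finset V → ℕ → Prop} (h : Q (G.postSet Z) 1) :
    Sat G (post Z) Q := by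
  refine ⟨by simp [Halts], ?_⟩
  intro b t e
  simp only [Exec] at e
  obtain ⟨rfl, rfl⟩ := e
  exact h

theorem sat_choose {α : Type u} {Z : Finset α} {Q : α → ℕ → Prop} (hZ : Z.Nonempty)
    (h : ∀ a ∈ Z, Q a 0) : Sat G (choose Z) Q := by
  refine ⟨by simpa [Halts] using hZ, ?_⟩
  intro b t e
  simp only [Exec] at e
  obtain ⟨hb, rfl⟩ := e
  exact h b hb

/-- The rule for loops: `Inv k s t` is an invariant of the state `s` and the number `t` of steps
so far, with the variant `k`. -/
theorem sat_loop {σ α : Type u} {body : σ → SymProg V (σ ⊕ α)} {s : σ} {Q : α → ℕ → Prop}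
    (Inv : ℕ → σ → ℕ → Prop) (k : ℕ) (h0 : Inv k s 0)
    (hbody : ∀ k s t, Inv k s t → Sat G (body s) fun x t' =>
      Sum.elim (fun s' => ∃ k' < k, Inv k' s' (t + t')) (fun a => Q a (t + t')) x) :
    Sat G (loop body s) Q := by
  have key : ∀ k s t, Inv k s t →
      LoopHalts (fun s => Halts G (body s)) (fun s x t => (body s).Exec G x t) s := by
    intro k
    induction k using Nat.strong_induction_on with
    | _ k ih =>
      intro s t hI
      refine LoopHalts.intro (hbody k s t hI).1 fun s' t' e => ?_
      obtain ⟨k', hk, hI'⟩ := (hbody k s t hI).2 _ _ e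
      exact ih k' hk s' _ hI'
  refine ⟨?_, ?_⟩
  · simp only [Halts]
    exact key k s 0 h0
  · intro a t e
    simp only [Exec] at e
    -- The induction on the run needs a clock that starts at an arbitrary time `t₀`.
    suffices ∀ s a t, LoopExec (fun s x t => (body s).Exec G x t) s a t →
        ∀ k t₀, Inv k s t₀ → Q a (t₀ + t) by
      simpa using this s a t e k 0 h0
    intro s a t e
    induction e with
    | done e =>
      intro k t₀ hI
      exact (hbody k _ t₀ hI).2 _ _ e
    | step e _ ih =>
      intro k t₀ hI
      obtain ⟨k', -, hI'⟩ := (hbody k _ t₀ hI).2 _ _ e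
      rw [← add_assoc]
      exact ih k' _ hI'

/-- The rule for `forEach`: `Inv R s t` is an invariant of the set `R` of the elements that are
still to be treated, the state `s`, and the number `t` of steps so far. -/
theorem sat_forEach {β σ α : Type u} [DecidableEq β] {Z : Finset β} {s : σ}
    {f : β → σ → SymProg V (σ ⊕ α)} {Q : σ ⊕ α → ℕ → Prop}
    (Inv : Finset β → σ → ℕ → Prop) (h0 : Inv Z s 0)
    (hstep : ∀ R s t, Inv R s t → ∀ b ∈ R, Sat G (f b s) fun x t' =>
      Sum.elim (fun s' => Inv (R.erase b) s' (t + t')) (fun a => Q (Sum.inr a) (t + t')) x)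
    (hend : ∀ s t, Inv ∅ s t → Q (Sum.inl s) t) : Sat G (forEach Z s f) Q := by
  refine sat_loop (fun k Rs t => k = Rs.1.card ∧ Inv Rs.1 Rs.2 t) Z.card ⟨rfl, h0⟩ ?_
  rintro k ⟨R, s⟩ t ⟨rfl, hI⟩
  dsimp only at hI ⊢
  split_ifs with hR
  · subst hR
    exact sat_pure (hend s t hI)
  · refine sat_bind (sat_choose (Finset.nonempty_iff_ne_empty.2 hR) fun b hb => ?_)
    refine sat_bind ((hstep R s t hI b hb).mono ?_)
    rintro (s' | a) t' h
    · refine sat_pure ⟨_, Finset.card_erase_lt_of_mem hb, rfl, ?_⟩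
      simpa using h
    · refine sat_pure ?_
      simpa using h

end TotalCorrectness

end SymProg

/-! ### Closed sets and strong connectivity -/

/-- `D` is a subset of `S` that contains every `v ∈ S` with `r v w` for some `w ∈ D`. -/
def ClosedIn {V : Type u} (r : V → V → Prop) (S D : Finset V) : Prop :=
  D ⊆ S ∧ ∀ v ∈ S, ∀ w ∈ D, r v w → v ∈ D

/-- `S` is nonempty, and the relation `r` is strongly connected on it. -/
def StronglyConn {V : Type u} (r : V → V → Prop) (S : Finset V) : Prop :=
  S.Nonempty ∧ ∀ D, ClosedIn r S D → D.Nonempty → D = S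

/-- `D` is the least closed subset of `S` that includes `N`. -/
def IsClosure {V : Type u} (r : V → V → Prop) (S N D : Finset V) : Prop :=
  ClosedIn r S D ∧ N ⊆ D ∧ ∀ D', ClosedIn r S D' → N ⊆ D' → D ⊆ D'

theorem ClosedIn.trans {V : Type u} {r : V → V → Prop} {S C D : Finset V}
    (h : ClosedIn r S C) (h' : ClosedIn r C D) : ClosedIn r S D :=
  ⟨h'.1.trans h.1, fun v hv w hw hr => h'.2 v (h.2 v hv w (h'.1 hw) hr) w hw hr⟩

/-- A vertex without a self-loop also counts, which is why a good component is separately required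
to contain an edge. -/
theorem stronglyConn_singleton {V : Type u} (r : V → V → Prop) (v : V) : StronglyConn r {v} := by
  refine ⟨Finset.singleton_nonempty v, fun D hD hne => ?_⟩
  exact (Finset.subset_singleton_iff.1 hD.1).resolve_left hne.ne_empty

section Closed

variable {V : Type u} [DecidableEq V] {r : V → V → Prop} {S D C I : Finset V}

theorem ClosedIn.compl (h : ClosedIn r S D) : ClosedIn (flip r) S (S \ D) := by
  refine ⟨Finset.sdiff_subset, fun v hv w hw hr => ?_⟩
  rw [Finset.mem_sdiff] at hw ⊢
  exact ⟨hv, fun hD => hw.2 (h.2 w hw.1 v hD hr)⟩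

theorem ClosedIn.inter (h : ClosedIn r S D) (hI : I ⊆ S) : ClosedIn r I (D ∩ I) := by
  refine ⟨Finset.inter_subset_right, fun v hv w hw hr => ?_⟩
  rw [Finset.mem_inter] at hw ⊢
  exact ⟨h.2 v (hI hv) w hw.1 hr, hv⟩

/-- The complement of a proper closed set for `flip r` would be a nonempty closed set for `r`, hence
all of `S`. -/
theorem StronglyConn.flip (h : StronglyConn r S) : StronglyConn (flip r) S := by
  refine ⟨h.1, fun D hD hne => ?_⟩
  by_contra hDS
  have hne' : (S \ D).Nonempty := by
    rw [Finset.sdiff_nonempty]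
    exact fun hs => hDS (hD.1.antisymm hs)
  have := h.2 _ hD.compl hne'
  obtain ⟨x, hx⟩ := hne
  have hx' := hD.1 hx
  rw [← this, Finset.mem_sdiff] at hx'
  exact hx'.2 hx

/-- `D ∩ I` is closed in `I`, so it is empty or all of `I`. This is why splitting a candidate along
a closed set loses no good component. -/
theorem StronglyConn.subset_or_disjoint (hI : StronglyConn r I) (hIS : I ⊆ S)
    (hD : ClosedIn r S D) : I ⊆ D ∨ I ⊆ S \ D := by
  by_cases hne : (D ∩ I).Nonempty
  · left
    rw [← hI.2 _ (hD.inter hIS) hne]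
    exact Finset.inter_subset_left
  · right
    intro x hx
    rw [Finset.mem_sdiff]
    exact ⟨hIS hx, fun hxD => hne ⟨x, Finset.mem_inter.2 ⟨hxD, hx⟩⟩⟩

/-- The vertices that `v` reaches in `S` and that reach `v` form a strongly connected set. -/
theorem IsClosure.stronglyConn {v : V} {F : Finset V} (hF : IsClosure (_root_.flip r) S {v} F)
    (hC : IsClosure r F {v} C) : StronglyConn r C := by
  refine ⟨⟨v, hC.2.1 (Finset.mem_singleton_self v)⟩, fun D hD hne => ?_⟩
  have hDF := hC.1.trans hD
  refine hD.1.antisymm (hC.2.2 D hDF ?_)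
  rw [Finset.singleton_subset_iff]
  by_contra hv
  -- If `D` omitted `v`, then `F \ D` would be successor-closed and contain `v`, hence include `F`,
  -- and `D` would be empty.
  have := hF.2.2 _ (hF.1.trans hDF.compl) (by
    rw [Finset.singleton_subset_iff, Finset.mem_sdiff]
    exact ⟨hF.2.1 (Finset.mem_singleton_self v), hv⟩)
  obtain ⟨x, hx⟩ := hne
  exact (Finset.mem_sdiff.1 (this (hDF.1 hx))).2 hx

end Closed

/-! ### Induced paths, breadth-first layers and guides -/

/-- An induced path, listed from its first vertex to its last: an edge leads from each vertex to the
next one, and no edge skips forward over a vertex. -/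
def IndPath {V : Type u} (G : Digraph V) : List V → Prop
  | [] => True
  | x :: l => (∀ y ∈ l.head?, G.Adj x y) ∧ (∀ z ∈ l.tail, ¬G.Adj x z) ∧ IndPath G l

/-- `S` is the vertex set of an induced path, and `N` consists of its last vertex. -/
def IsGuide {V : Type u} [DecidableEq V] (G : Digraph V) (S N : Finset V) : Prop :=
  ∃ l : List V, IndPath G l ∧ S = l.toFinset ∧ N = l.getLast?.toFinset

/-- A list of breadth-first layers, the last layer first. -/
def Layered {V : Type u} (G : Digraph V) : List (Finset V) → Prop
  | [] => True
  | L :: rest => L.Nonempty ∧ (∀ L' ∈ rest, Disjoint L L') ∧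
      (∀ L' ∈ rest.head?, ∀ y ∈ L, ∃ x ∈ L', G.Adj x y) ∧
      (∀ L' ∈ rest.tail, ∀ x ∈ L', ∀ y ∈ L, ¬G.Adj x y) ∧ Layered G rest

section Paths

variable {V : Type u} {G : Digraph V}

theorem IndPath.backward {l : List V} (hl : IndPath G l) {F C : V → Prop}
    (hF : ∀ x ∈ l, ∀ y ∈ l, G.Adj x y → F x → F y)
    (hC : ∀ x ∈ l, ∀ y ∈ l, G.Adj x y → F x → C y → C x)
    (hlast : ∀ v ∈ l.getLast?, C v) : ∀ x ∈ l, F x → C x := by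
  induction l with
  | nil => simp
  | cons a l ih =>
    obtain ⟨h1, -, h3⟩ := hl
    cases l with
    | nil => simpa using fun _ => hlast
    | cons b l =>
      have ih := ih h3 (fun x hx y hy => hF x (by simp [hx]) y (by simp [hy]))
        (fun x hx y hy => hC x (by simp [hx]) y (by simp [hy])) (by simpa using hlast)
      intro x hx hFx
      rcases List.mem_cons.1 hx with rfl | hx
      · have hab := h1 b (by simp)
        exact hC x (by simp) b (by simp) hab hFx
          (ih b (by simp) (hF x (by simp) b (by simp) hab hFx))
      · exact ih x hx hFx

theorem IndPath.forward {l : List V} {a : V} (hl : IndPath G (a :: l)) {C : V → Prop}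
    (hC : ∀ x ∈ a :: l, ∀ y ∈ a :: l, G.Adj x y → C x → C y) (ha : C a) : ∀ x ∈ l, C x := by
  induction l generalizing a with
  | nil => simp
  | cons b l ih =>
    have hb : C b := hC a (by simp) b (by simp) (hl.1 b (by simp)) ha
    have := ih hl.2.2 (fun x hx y hy => hC x (List.mem_cons_of_mem _ hx) y
      (List.mem_cons_of_mem _ hy)) hb
    intro x hx
    rcases List.mem_cons.1 hx with rfl | hx
    · exact hb
    · exact this x hx

/-- Removing a final segment from an induced path leaves an induced path, and its last vertex is the
only one with an edge into the segment. -/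
theorem IndPath.filter_not {l : List V} (hl : IndPath G l) {P : V → Prop} [DecidablePred P]
    (hP : ∀ x ∈ l, ∀ y ∈ l, G.Adj x y → P x → P y) (hlast : ∀ v ∈ l.getLast?, P v) :
    IndPath G (l.filter fun x => ¬P x) ∧ ∀ z, (z ∈ l ∧ ¬P z ∧ ∃ w ∈ l, P w ∧ G.Adj z w) ↔
      z ∈ (l.filter fun x => ¬P x).getLast? := by
  induction l with
  | nil => simp [IndPath]
  | cons a l ih =>
    by_cases ha : P a
    · have hall := hl.forward hP ha
      have : (a :: l).filter (fun x => ¬P x) = [] := by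
        simpa [List.filter_eq_nil_iff] using ⟨ha, hall⟩
      rw [this]
      refine ⟨trivial, fun z => ?_⟩
      simp only [List.getLast?_nil, Option.not_mem_none, iff_false]
      rintro ⟨hz, hPz, -⟩
      rcases List.mem_cons.1 hz with rfl | hz
      exacts [hPz ha, hPz (hall z hz)]
    · have hfa : (a :: l).filter (fun x => ¬P x) = a :: l.filter (fun x => ¬P x) := by
        simp [ha]
      cases l with
      | nil => exact absurd (hlast a (by simp)) ha
      | cons b l =>
        obtain ⟨h1, h2, h3⟩ := hl
        have hP' : ∀ x ∈ b :: l, ∀ y ∈ b :: l, G.Adj x y → P x → P y :=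
          fun x hx y hy => hP x (List.mem_cons_of_mem _ hx) y (List.mem_cons_of_mem _ hy)
        obtain ⟨ih1, ih2⟩ := ih h3 hP' (by simpa using hlast)
        have hab := h1 b (by simp)
        rw [hfa]
        by_cases hb : P b
        · have hall := h3.forward hP' hb
          have : (b :: l).filter (fun x => ¬P x) = [] := by
            simpa [List.filter_eq_nil_iff] using ⟨hb, hall⟩
          rw [this]
          refine ⟨by simp [IndPath], fun z => ?_⟩
          simp only [List.getLast?_singleton, Option.mem_some_iff]
          constructor
          · rintro ⟨hz, hPz, -⟩
            rcases List.mem_cons.1 hz with rfl | hz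
            · rfl
            · rcases List.mem_cons.1 hz with rfl | hz
              exacts [absurd hb hPz, absurd (hall z hz) hPz]
          · rintro rfl
            exact ⟨by simp, ha, b, by simp, hb, hab⟩
        · have hfb : (b :: l).filter (fun x => ¬P x) = b :: l.filter (fun x => ¬P x) := by
            simp [hb]
          rw [hfb] at ih1 ih2 ⊢
          refine ⟨⟨by simpa using hab, fun z hz => h2 z ?_, ih1⟩, fun z => ?_⟩
          · simp only [List.tail_cons, List.mem_filter] at hz ⊢
            exact hz.1
          · rw [List.getLast?_cons_cons, ← ih2 z]
            constructor
            · rintro ⟨hz, hPz, w, hw, hPw, hzw⟩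
              have hw' : w ∈ b :: l := by
                rcases List.mem_cons.1 hw with rfl | hw
                exacts [absurd hPw ha, hw]
              refine ⟨?_, hPz, w, hw', hPw, hzw⟩
              -- The head has no edge into the segment: the only later vertex it points to is `b`,
              -- which lies outside. This is where inducedness is needed.
              rcases List.mem_cons.1 hz with rfl | hz
              · rcases List.mem_cons.1 hw' with rfl | hw'
                exacts [absurd hPw hb, absurd hzw (h2 w hw')]
              · exact hz
            · rintro ⟨hz, hPz, w, hw, hPw, hzw⟩
              exact ⟨List.mem_cons_of_mem _ hz, hPz, w, List.mem_cons_of_mem _ hw, hPw, hzw⟩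

/-- Removing an initial segment from an induced path leaves an induced path with the same last
vertex, if any. -/
theorem IndPath.filter_not_initial {l : List V} (hl : IndPath G l) {P : V → Prop}
    [DecidablePred P] (hP : ∀ x ∈ l, ∀ y ∈ l, G.Adj x y → P y → P x) :
    IndPath G (l.filter fun x => ¬P x) ∧
      ∀ z, z ∈ (l.filter fun x => ¬P x).getLast? ↔ z ∈ l.getLast? ∧ ¬P z := by
  induction l with
  | nil => simp [IndPath]
  | cons a l ih =>
    by_cases ha : P a
    · have hfa : (a :: l).filter (fun x => ¬P x) = l.filter (fun x => ¬P x) := by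
        simp [ha]
      rw [hfa]
      obtain ⟨ih1, ih2⟩ := ih hl.2.2 fun x hx y hy =>
        hP x (List.mem_cons_of_mem _ hx) y (List.mem_cons_of_mem _ hy)
      refine ⟨ih1, fun z => ?_⟩
      rw [ih2 z]
      cases l with
      | nil =>
        simp only [List.getLast?_nil, Option.not_mem_none, false_and, List.getLast?_singleton,
          Option.mem_some_iff, false_iff, not_and, not_not]
        rintro rfl
        exact ha
      | cons b l => rw [List.getLast?_cons_cons]
    · have hall := hl.forward (C := fun x => ¬P x)
        (fun x hx y hy hxy hx' hy' => hx' (hP x hx y hy hxy hy')) ha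
      have hall' : ∀ x ∈ a :: l, ¬P x := by
        intro x hx
        rcases List.mem_cons.1 hx with rfl | hx
        exacts [ha, hall x hx]
      have : (a :: l).filter (fun x => ¬P x) = a :: l := by
        rw [List.filter_eq_self]
        simpa using hall'
      rw [this]
      exact ⟨hl, fun z => ⟨fun hz => ⟨hz, hall' z (List.mem_of_getLast? hz)⟩, fun hz => hz.1⟩⟩

end Paths

section Guides

variable {V : Type u} [DecidableEq V] {G : Digraph V}

theorem isGuide_empty : IsGuide G ∅ ∅ := ⟨[], trivial, by simp, by simp⟩

theorem IsGuide.eq_singleton {S N : Finset V} (h : IsGuide G S N) (hS : S ≠ ∅) :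
    ∃ v ∈ S, N = {v} := by
  obtain ⟨l, -, rfl, rfl⟩ := h
  cases hl : l.getLast? with
  | none => simp_all
  | some v => exact ⟨v, by simpa using List.mem_of_getLast? hl, by simp⟩

/-- Once on the path in `F`, one stays in `F` up to the end, which lies in `C`; going back from the
end one stays in `C`. So every vertex of the old guide that a forward search meets leaves with the
component, and a vertex joins a guide at most once. -/
theorem IsGuide.inter_subset {A S N F C : Finset V} (h : IsGuide G S N) (hSA : S ⊆ A)
    (hF : ClosedIn (flip G.Adj) A F) (hC : ClosedIn G.Adj F C) (hN : N ⊆ C) : S ∩ F ⊆ C := by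
  obtain ⟨l, hl, rfl, rfl⟩ := h
  have := hl.backward (F := (· ∈ F)) (C := (· ∈ C))
    (fun x hx y hy hxy hxF => hF.2 y (hSA (by simpa using hy)) x hxF hxy)
    (fun x hx y hy hxy hxF hyC => hC.2 x hxF y hyC hxy)
    (fun v hv => hN (by simpa using hv))
  intro x hx
  rw [Finset.mem_inter, List.mem_toFinset] at hx
  exact this x hx.1 hx.2

/-- `C` takes a final segment of the path. As no edge skips forward, the only remaining path vertex
with an edge into that segment is the new end, so a single `Pre` finds it. -/
theorem IsGuide.sdiff_final {A S N F C P : Finset V} (h : IsGuide G S N) (hSA : S ⊆ A)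
    (hF : ClosedIn (flip G.Adj) A F) (hC : ClosedIn G.Adj F C) (hN : N ⊆ C)
    (hP : ∀ v, v ∈ P ↔ ∃ w ∈ C ∩ S, G.Adj v w) : IsGuide G (S \ C) (P ∩ (S \ C)) := by
  have hsub := h.inter_subset hSA hF hC hN
  obtain ⟨l, hl, rfl, rfl⟩ := h
  obtain ⟨h1, h2⟩ := hl.filter_not (P := (· ∈ C))
    (fun x hx y hy hxy hxC => hsub (Finset.mem_inter.2 ⟨by simpa using hy,
      hF.2 y (hSA (by simpa using hy)) x (hC.1 hxC) hxy⟩))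
    (fun v hv => hN (by simpa using hv))
  refine ⟨_, h1, ?_, ?_⟩
  · ext x
    simp
  · ext z
    rw [Option.mem_toFinset, ← h2 z]
    simp only [Finset.mem_inter, hP, Finset.mem_sdiff, List.mem_toFinset]
    grind

/-- `C` contains the predecessors in `F` of its vertices, so it takes an initial segment of the
path. -/
theorem IsGuide.sdiff_initial {S N F C : Finset V} (h : IsGuide G S N) (hSF : S ⊆ F)
    (hC : ClosedIn G.Adj F C) : IsGuide G (S \ C) (N \ C) := by
  obtain ⟨l, hl, rfl, rfl⟩ := h
  obtain ⟨h1, h2⟩ := hl.filter_not_initial (P := (· ∈ C))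
    (fun x hx y hy hxy hyC => hC.2 x (hSF (by simpa using hx)) y hyC hxy)
  refine ⟨_, h1, ?_, ?_⟩
  · ext x
    simp
  · ext z
    rw [Option.mem_toFinset, h2 z]
    simp

end Guides

theorem mem_preSet {V : Type u} [Fintype V] {G : Digraph V} [DecidableRel G.Adj]
    {Z : Finset V} {v : V} :
    v ∈ G.preSet Z ↔ ∃ w ∈ Z, G.Adj v w := by
  simp [Digraph.preSet]

theorem mem_postSet {V : Type u} [Fintype V] {G : Digraph V} [DecidableRel G.Adj]
    {Z : Finset V} {v : V} :
    v ∈ G.postSet Z ↔ ∃ w ∈ Z, G.Adj w v := by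
  simp [Digraph.postSet]

/-! ### Symbolic reachability and computation of the components -/

section Programs

variable {V : Type u} [Fintype V] [DecidableEq V] {G : Digraph V} [DecidableRel G.Adj]

/-- Backward search within `S`. -/
theorem sat_backward {S N : Finset V} (hN : N ⊆ S) {g : Finset V → Finset V}
    (hg : ∀ P, g P = P ∩ S) :
    Sat G (loop (fun R : Finset V => do
      let P ← pre R
      if g P ⊆ R then return Sum.inr R else return Sum.inl (R ∪ g P)) N)
      fun D t => IsClosure G.Adj S N D ∧ t + N.card ≤ D.card + 1 := by
  have hle := Finset.card_le_card hN
  refine sat_loop (fun k R t => N ⊆ R ∧ R ⊆ S ∧ (∀ D, ClosedIn G.Adj S D → N ⊆ D → R ⊆ D) ∧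
    k + R.card = S.card ∧ t + N.card ≤ R.card) (S.card - N.card)
    ⟨subset_rfl, hN, fun D _ h => h, by omega, by omega⟩ ?_
  rintro k R t ⟨h1, h2, h3, h4, h5⟩
  refine sat_bind (sat_pre ?_)
  rw [hg]
  split_ifs with h
  · refine sat_pure ⟨⟨⟨h2, fun v hv w hw hvw => h ?_⟩, h1, h3⟩, by omega⟩
    exact Finset.mem_inter.2 ⟨mem_preSet.2 ⟨w, hw, hvw⟩, hv⟩
  · have hsub : R ∪ G.preSet R ∩ S ⊆ S := Finset.union_subset h2 Finset.inter_subset_right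
    have hlt : R.card < (R ∪ G.preSet R ∩ S).card := by
      refine Finset.card_lt_card (Finset.ssubset_iff_subset_ne.2
        ⟨Finset.subset_union_left, fun he => h ?_⟩)
      exact (Finset.union_eq_left.1 he.symm)
    have hle' := Finset.card_le_card hsub
    refine sat_pure ⟨S.card - (R ∪ G.preSet R ∩ S).card, by omega,
      h1.trans Finset.subset_union_left, hsub, fun D hD hND => ?_, by omega, by omega⟩
    refine Finset.union_subset (h3 D hD hND) fun v hv => ?_
    rw [Finset.mem_inter, mem_preSet] at hv
    obtain ⟨⟨w, hw, hvw⟩, hvS⟩ := hv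
    exact hD.2 v hvS w (h3 D hD hND hw) hvw

theorem sat_symReach (Z : Finset V) :
    Sat G (symReach Z) fun D t => IsClosure G.Adj Finset.univ Z D ∧ t ≤ Fintype.card V + 1 := by
  -- The search is not confined to a subset: intersecting with `Finset.univ` changes nothing, so `g`
  -- is the identity.
  refine (sat_backward (g := id) (Finset.subset_univ Z) (fun P => by simp)).mono ?_
  rintro D t ⟨h, h'⟩
  have := Finset.card_le_univ D
  exact ⟨h, by omega⟩

theorem sat_forwardLayers {A N : Finset V} (hN : N ⊆ A) :
    Sat G (forwardLayers A N) fun x t => IsClosure (flip G.Adj) A N x.1 ∧ Layered G x.2 ∧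
      (∀ v, v ∈ x.1 ↔ ∃ L ∈ x.2, v ∈ L) ∧ t = x.2.length := by
  refine sat_loop (fun k st t => k + st.2.1.card = A.card ∧ Disjoint st.1 st.2.1 ∧
    N ⊆ st.2.1 ∪ st.1 ∧ st.2.1 ∪ st.1 ⊆ A ∧
    (∀ D, ClosedIn (flip G.Adj) A D → N ⊆ D → st.2.1 ∪ st.1 ⊆ D) ∧
    (∀ x ∈ st.2.1, ∀ y ∈ A, G.Adj x y → y ∈ st.2.1 ∪ st.1) ∧ Layered G st.2.2 ∧
    (∀ v, v ∈ st.2.1 ↔ ∃ L ∈ st.2.2, v ∈ L) ∧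
    (∀ L' ∈ st.2.2.head?, ∀ y ∈ st.1, ∃ x ∈ L', G.Adj x y) ∧
    (∀ L' ∈ st.2.2.tail, ∀ x ∈ L', ∀ y ∈ st.1, ¬G.Adj x y) ∧ t = st.2.2.length) A.card ?_ ?_
  · simp [Layered, hN]
  rintro k ⟨L, FW, stack⟩ t ⟨h1, h2, h3, h4, h5, h6, h7, h8, h9, h10, h11⟩
  dsimp only at h1 h2 h3 h4 h5 h6 h7 h8 h9 h10 h11 ⊢
  split_ifs with h
  · subst h
    rw [Finset.union_empty] at *
    exact sat_pure ⟨⟨⟨h4, fun v hv w hw hvw => by simpa using h6 w hw v hv hvw⟩, h3, h5⟩, h7, h8,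
      h11⟩
  · refine sat_bind (sat_post ?_)
    have hL := Finset.nonempty_iff_ne_empty.2 h
    have hcard := Finset.card_le_card h4
    rw [Finset.card_union_of_disjoint h2.symm] at hcard
    have hpos := hL.card_pos
    refine sat_pure ⟨k - L.card, by omega, ?_, ?_, ?_, ?_, ?_, ?_, ⟨hL, ?_, h9, h10, h7⟩,
      ?_, ?_, ?_, ?_⟩ <;> try dsimp only
    · rw [Finset.card_union_of_disjoint h2.symm]
      omega
    · exact Finset.sdiff_disjoint
    · exact h3.trans Finset.subset_union_left
    · refine Finset.union_subset h4 (Finset.sdiff_subset.trans Finset.inter_subset_right)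
    · intro D hD hND
      refine Finset.union_subset (h5 D hD hND) fun v hv => ?_
      rw [Finset.mem_sdiff, Finset.mem_inter, mem_postSet] at hv
      obtain ⟨⟨⟨w, hw, hwv⟩, hvA⟩, -⟩ := hv
      exact hD.2 v hvA w (h5 D hD hND (Finset.mem_union_right _ hw)) hwv
    · intro x hx y hy hxy
      rcases Finset.mem_union.1 hx with hx | hx
      · exact Finset.mem_union_left _ (h6 x hx y hy hxy)
      · by_cases hy' : y ∈ FW ∪ L
        · exact Finset.mem_union_left _ hy'
        · refine Finset.mem_union_right _ ?_
          rw [Finset.mem_sdiff, Finset.mem_inter, mem_postSet]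
          exact ⟨⟨⟨x, hx, hxy⟩, hy⟩, hy'⟩
    · intro L' hL'
      refine h2.mono_right fun v hv => (h8 v).2 ⟨L', hL', hv⟩
    · intro v
      rw [Finset.mem_union, h8]
      simp [or_comm]
    · intro L' hL' y hy
      simp only [List.head?_cons, Option.mem_some_iff] at hL'
      subst hL'
      rw [Finset.mem_sdiff, Finset.mem_inter, mem_postSet] at hy
      exact hy.1.1
    · intro L' hL' x hx y hy hxy
      rw [List.tail_cons] at hL'
      rw [Finset.mem_sdiff, Finset.mem_inter] at hy
      exact hy.2 (h6 x ((h8 x).2 ⟨L', hL', hx⟩) y hy.1.2 hxy)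
    · simp [h11]

theorem sat_skelForward {A N : Finset V} (hN : N ⊆ A) (hne : N.Nonempty) :
    Sat G (skelForward A N) fun x t => IsClosure (flip G.Adj) A N x.1 ∧ x.2.1 ⊆ x.1 ∧
      IsGuide G x.2.1 x.2.2 ∧ t ≤ 2 * x.2.1.card := by
  refine sat_bind ((sat_forwardLayers hN).mono ?_)
  rintro ⟨FW, stack⟩ t ⟨hFW, hlay, hmem, rfl⟩
  dsimp only at *
  cases stack with
  | nil =>
    obtain ⟨x, hx⟩ := hne
    simpa using (hmem x).1 (hFW.2.1 hx)
  | cons L rest =>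
    dsimp only
    refine sat_bind (sat_choose hlay.1 fun v hv => ?_)
    refine sat_bind (Sat.mono (Q := fun newS t => newS ⊆ FW ∧ IsGuide G newS {v} ∧
      t + (L :: rest).length ≤ 2 * newS.card) ?_ ?_)
    -- The path `x :: l` built so far starts in the layer `L'`. The layers still to come are
    -- disjoint from it and have no edges to its tail `l`.
    · refine sat_loop (fun k st t => k = st.1.length ∧ ∃ L' x l, st.2 = (x :: l).toFinset ∧
        IndPath G (x :: l) ∧ (x :: l).getLast? = some v ∧ x ∈ L' ∧ Layered G (L' :: st.1) ∧
        (∀ L'' ∈ st.1, ∀ z ∈ L'', z ∉ x :: l ∧ ∀ w ∈ l, ¬G.Adj z w) ∧ st.2 ⊆ FW ∧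
        (∀ L'' ∈ st.1, L'' ⊆ FW) ∧ st.2.card + st.1.length = (L :: rest).length ∧
        t + st.1.length + 1 = (L :: rest).length) rest.length ?_ ?_
      · refine ⟨rfl, L, v, [], by simp, by simp [IndPath], by simp, hv, hlay, ?_, ?_, ?_, ?_, ?_⟩
        · intro L'' hL'' z hz
          refine ⟨?_, by simp⟩
          rw [List.mem_singleton]
          rintro rfl
          exact Finset.disjoint_left.1 (hlay.2.1 L'' hL'') hv hz
        · simpa using (hmem v).2 ⟨L, by simp, hv⟩
        · exact fun L'' hL'' z hz => (hmem z).2 ⟨L'', by simp [hL''], hz⟩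
        · simp [add_comm]
        · simp
      · rintro k ⟨rest, S⟩ t ⟨rfl, L', x, l, rfl, hind, hlast, hx, hlay', hout, hsub, hsub', hc,
          ht⟩
        dsimp only at *
        cases rest with
        | nil =>
          refine sat_pure ⟨hsub, ⟨_, hind, rfl, ?_⟩, ?_⟩
          · rw [hlast]
            simp
          · simp only [List.length_nil] at hc ht
            omega
        | cons L₂ rest' =>
          dsimp only
          refine sat_bind (sat_pre (sat_bind (sat_choose ?_ fun w hw => sat_pure ?_)))
          · obtain ⟨w, hw, hwx⟩ := hlay'.2.2.1 L₂ (by simp) x hx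
            exact ⟨w, Finset.mem_inter.2 ⟨mem_preSet.2 ⟨x, by simp, hwx⟩, hw⟩⟩
          · rw [Finset.mem_inter, mem_preSet] at hw
            obtain ⟨⟨y, hy, hwy⟩, hwL⟩ := hw
            obtain ⟨hwl, hwn⟩ := hout L₂ (by simp) w hwL
            -- `w` may precede only the head `x`, since edges from its layer do not reach layers
            -- beyond the next. So the path stays induced.
            have hwx : G.Adj w x := by
              rw [List.mem_toFinset] at hy
              rcases List.mem_cons.1 hy with rfl | hy
              exacts [hwy, absurd hwy (hwn y hy)]
            refine ⟨rest'.length, by simp, rfl, L₂, w, x :: l, by simp, ⟨by simpa using hwx, hwn,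
              hind⟩, by rw [List.getLast?_cons_cons, hlast], hwL, hlay'.2.2.2.2, ?_, ?_, ?_, ?_, ?_⟩
            · intro L'' hL'' z hz
              obtain ⟨hz1, hz2⟩ := hout L'' (List.mem_cons_of_mem _ hL'') z hz
              refine ⟨?_, ?_⟩
              · rw [List.mem_cons, not_or]
                refine ⟨?_, hz1⟩
                rintro rfl
                exact Finset.disjoint_left.1 (hlay'.2.2.2.2.2.1 L'' hL'') hwL hz
              · intro u hu
                rcases List.mem_cons.1 hu with rfl | hu
                exacts [hlay'.2.2.2.1 L'' hL'' z hz u hx, hz2 u hu]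
            · exact Finset.insert_subset (hsub' L₂ (by simp) hwL) hsub
            · exact fun L'' hL'' => hsub' L'' (List.mem_cons_of_mem _ hL'')
            · rw [Finset.card_insert_of_notMem (by rwa [List.mem_toFinset])]
              simp only [List.length_cons] at hc ⊢
              omega
            · simp only [List.length_cons] at ht ⊢
              omega
    · rintro newS t ⟨h1, h2, h3⟩
      exact sat_pure ⟨hFW, h1, h2, by dsimp only; omega⟩

/-- `F` is a set of disjoint strongly connected subsets of `A`, one of which includes any given
strongly connected subset of `A`. -/
def IsSCCs (G : Digraph V) (A : Finset V) (F : Finset (Finset V)) : Prop :=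
  (∀ D ∈ F, StronglyConn G.Adj D ∧ D ⊆ A) ∧ (F : Set (Finset V)).PairwiseDisjoint id ∧
    ∀ I ⊆ A, StronglyConn G.Adj I → ∃ D ∈ F, I ⊆ D

/-- Amortisation: in a pending call, a vertex has credit 6 off the guide and 4 on it. Processing a
call costs at most `2|newS| + |C| + 1` steps. The vertices of `newS \ C` were not on the old guide
(`IsGuide.inter_subset`) and release 2 each, and those of `C` release at least 4 each; this suffices
because `|newS| ≤ |newS \ C| + |C|` and `|C| ≥ 1`. -/
theorem sat_allSCCs (A : Finset V) :
    Sat G (allSCCs A) fun F t => IsSCCs G A F ∧ t ≤ 6 * A.card := by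
  refine sat_loop (fun k st t =>
    -- Replacing a call by two adds one, but removing the component subtracts at least two; the `+
    -- 1` also makes popping an empty call a decrease.
    k = (st.1.map fun e => 2 * e.1.card + 1).sum ∧
    t + (st.1.map fun e => 4 * e.1.card + 2 * (e.1 \ e.2.1).card).sum ≤ 6 * A.card ∧
    (∀ e ∈ st.1, e.1 ⊆ A ∧ e.2.1 ⊆ e.1 ∧ IsGuide G e.2.1 e.2.2) ∧
    (∀ D ∈ st.2, StronglyConn G.Adj D ∧ D ⊆ A) ∧
    (st.2 : Set (Finset V)).PairwiseDisjoint id ∧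
    st.1.Pairwise (fun e e' => Disjoint e.1 e'.1) ∧
    (∀ D ∈ st.2, ∀ e ∈ st.1, Disjoint D e.1) ∧
    ∀ I ⊆ A, StronglyConn G.Adj I → (∃ D ∈ st.2, I ⊆ D) ∨ ∃ e ∈ st.1, I ⊆ e.1) _
    ⟨rfl, ?_, ?_, ?_, ?_, ?_, ?_, ?_⟩ ?_
  · simp only [List.map_cons, List.map_nil, List.sum_cons, List.sum_nil, Finset.sdiff_empty]
    omega
  · simp [isGuide_empty]
  · simp
  · simp
  · simp
  · simp
  · intro I hI _
    exact Or.inr ⟨_, List.mem_cons_self, hI⟩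
  rintro k ⟨todo, sccs⟩ t ⟨rfl, ht, htodo, hscc, hdis, htdis, hdis', hcov⟩
  dsimp only at *
  cases todo with
  | nil =>
    refine sat_pure ⟨⟨hscc, hdis, fun I hI hIs => ?_⟩, ?_⟩
    · simpa using hcov I hI hIs
    · simpa using ht
  | cons e todo =>
    obtain ⟨B, S, N⟩ := e
    dsimp only
    obtain ⟨hBA, hSB, hguide⟩ := htodo _ List.mem_cons_self
    dsimp only at hBA hSB hguide
    simp only [List.map_cons, List.sum_cons] at ht ⊢
    rw [List.pairwise_cons] at htdis
    by_cases hB : B = ∅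
    · rw [if_pos hB]
      subst hB
      refine sat_pure ⟨_, ?_, rfl, ?_, fun e he => htodo e (List.mem_cons_of_mem _ he), hscc, hdis,
        htdis.2, fun D hD e he => hdis' D hD e (List.mem_cons_of_mem _ he), fun I hI hIs => ?_⟩
      · simp
      · simpa using ht
      · rcases hcov I hI hIs with h | ⟨e, he, hIe⟩
        · exact Or.inl h
        · rcases List.mem_cons.1 he with rfl | he
          · exact absurd (Finset.subset_empty.1 hIe) hIs.1.ne_empty
          · exact Or.inr ⟨e, he, hIe⟩
    · rw [if_neg hB]
      refine sat_bind (Sat.mono (Q := fun N' t' => t' = 0 ∧ ∃ v ∈ B, N' = {v} ∧ N ⊆ N') ?_ ?_)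
      · split_ifs with hS
        · refine sat_bind (sat_choose (Finset.nonempty_iff_ne_empty.2 hB) fun v hv =>
            sat_pure ⟨rfl, v, hv, rfl, ?_⟩)
          obtain ⟨l, -, hl, rfl⟩ := hguide
          have : l = [] := by
            rw [← List.toFinset_eq_empty_iff, ← hl, hS]
          simp [this]
        · obtain ⟨v, hv, rfl⟩ := hguide.eq_singleton hS
          exact sat_pure ⟨rfl, v, hSB hv, rfl, subset_rfl⟩
      rintro N' t' ⟨rfl, v, hv, rfl, hNv⟩
      refine sat_bind ((sat_skelForward (Finset.singleton_subset_iff.2 hv)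
        (Finset.singleton_nonempty v)).mono ?_)
      rintro ⟨FW, newS, newN⟩ t₁ ⟨hFW, hnewS, hnew, ht₁⟩
      dsimp only at *
      refine sat_bind ((sat_backward (g := (· ∩ FW)) hFW.2.1 (fun P => rfl)).mono ?_)
      rintro C t₂ ⟨hC, ht₂⟩
      refine sat_bind (sat_pre ?_)
      have hNC : N ⊆ C := hNv.trans hC.2.1
      have hsub := hguide.inter_subset hSB hFW.1 hC.1 hNC
      have hCF := hC.1.1
      have hFB := hFW.1.1
      have hCne : C.Nonempty := ⟨v, hC.2.1 (Finset.mem_singleton_self v)⟩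
      have hCS : StronglyConn G.Adj C := hFW.stronglyConn hC
      have c1 := Finset.card_sdiff_add_card_eq_card hFB
      have c2 := Finset.card_sdiff_add_card_eq_card hCF
      have c3 : ((B \ FW) \ (S \ C)).card + (FW \ C).card ≤ (B \ S).card := by
        rw [← Finset.card_union_of_disjoint]
        · refine Finset.card_le_card ?_
          grind
        · rw [Finset.disjoint_left]
          grind
      have c4 : ((FW \ C) \ (newS \ C)).card + (newS \ C).card = (FW \ C).card :=
        Finset.card_sdiff_add_card_eq_card (Finset.sdiff_subset_sdiff hnewS subset_rfl)
      have c5 : newS.card ≤ (newS \ C).card + C.card := by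
        have := Finset.card_le_card (Finset.subset_union_left (s₁ := newS) (s₂ := C))
        rwa [← Finset.sdiff_union_self_eq_union,
          Finset.card_union_of_disjoint Finset.sdiff_disjoint] at this
      have c6 := hCne.card_pos
      rw [Finset.card_singleton] at ht₂
      have hCtodo : ∀ e ∈ todo, ∀ X ⊆ B, Disjoint X e.1 :=
        fun e he X hX => (htdis.1 e he).mono_left hX
      refine sat_pure ⟨_, ?_, rfl, ?_, ?_, ?_, ?_, ?_, ?_, ?_⟩ <;>
        simp only [List.map_cons, List.sum_cons]
      · omega
      · omega
      · intro e he
        rcases List.mem_cons.1 he with rfl | he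
        · refine ⟨Finset.sdiff_subset.trans hBA, ?_, ?_⟩
          · grind
          · exact hguide.sdiff_final hSB hFW.1 hC.1 hNC fun v => mem_preSet
        · rcases List.mem_cons.1 he with rfl | he
          · exact ⟨Finset.sdiff_subset.trans (hFB.trans hBA),
              Finset.sdiff_subset_sdiff hnewS subset_rfl, hnew.sdiff_initial hnewS hC.1⟩
          · exact htodo e (List.mem_cons_of_mem _ he)
      · intro D hD
        rcases Finset.mem_insert.1 hD with rfl | hD
        · exact ⟨hCS, hCF.trans (hFB.trans hBA)⟩
        · exact hscc D hD
      · rw [Finset.coe_insert]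
        refine hdis.insert fun D hD _ => ?_
        exact ((hdis' D hD _ List.mem_cons_self).mono_right (hCF.trans hFB)).symm
      · rw [List.pairwise_cons, List.pairwise_cons]
        refine ⟨fun e he => ?_, fun e he => hCtodo e he _ (Finset.sdiff_subset.trans hFB),
          htdis.2⟩
        rcases List.mem_cons.1 he with rfl | he
        · exact Finset.sdiff_disjoint.mono_right Finset.sdiff_subset
        · exact hCtodo e he _ Finset.sdiff_subset
      · intro D hD e he
        rcases Finset.mem_insert.1 hD with rfl | hD
        · rcases List.mem_cons.1 he with rfl | he
          · exact Finset.disjoint_sdiff.mono_left hCF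
          · rcases List.mem_cons.1 he with rfl | he
            · exact Finset.disjoint_sdiff
            · exact hCtodo e he _ (hCF.trans hFB)
        · have hDB := hdis' D hD _ List.mem_cons_self
          rcases List.mem_cons.1 he with rfl | he
          · exact hDB.mono_right Finset.sdiff_subset
          · rcases List.mem_cons.1 he with rfl | he
            · exact hDB.mono_right (Finset.sdiff_subset.trans hFB)
            · exact hdis' D hD e (List.mem_cons_of_mem _ he)
      · intro I hI hIs
        rcases hcov I hI hIs with ⟨D, hD, hID⟩ | ⟨e, he, hIe⟩
        · exact Or.inl ⟨D, Finset.mem_insert_of_mem hD, hID⟩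
        · rcases List.mem_cons.1 he with rfl | he
          · rcases hIs.flip.subset_or_disjoint hIe hFW.1 with h | h
            · rcases hIs.subset_or_disjoint h hC.1 with h' | h'
              · exact Or.inl ⟨C, Finset.mem_insert_self _ _, h'⟩
              · exact Or.inr ⟨_, List.mem_cons_of_mem _ List.mem_cons_self, h'⟩
            · exact Or.inr ⟨_, List.mem_cons_self, h⟩
          · exact Or.inr ⟨e, List.mem_cons_of_mem _ (List.mem_cons_of_mem _ he), hIe⟩

end Programs

/-! ### Lock-step search -/

/-- Every nonempty closed subset of `S` contains an element of `H`. -/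
def Meets {V : Type u} (r : V → V → Prop) (S H : Finset V) : Prop :=
  ∀ D, ClosedIn r S D → D.Nonempty → ∃ h ∈ H, h ∈ D

/-- The invariant of the lock-step searches along `r` in `S`: what has been reached from `h ∈ H` is
`C h`, and contains at least `ρ` vertices. -/
def SearchInv {V : Type u} (r : V → V → Prop) (S : Finset V) (ρ : ℕ) (H : Finset V)
    (C : V → Finset V) : Prop :=
  H ⊆ S ∧ Meets r S H ∧ ∀ h ∈ H, h ∈ C h ∧ C h ⊆ S ∧
    (∀ D, ClosedIn r S D → h ∈ D → C h ⊆ D) ∧ ρ ≤ (C h).card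

/-- `D` contains a start vertex and hence all that its search has reached. Applied to the set found,
and in the opposite direction to its complement, this bounds the number of rounds. -/
theorem SearchInv.le_card {V : Type u} {r : V → V → Prop} {S H D : Finset V} {ρ : ℕ}
    {C : V → Finset V} (h : SearchInv r S ρ H C) (hD : ClosedIn r S D) (hne : D.Nonempty) :
    ρ ≤ D.card := by
  obtain ⟨x, hx, hxD⟩ := h.2.1 D hD hne
  obtain ⟨-, -, h3, h4⟩ := h.2.2 x hx
  exact h4.trans (Finset.card_le_card (h3 D hD hxD))

theorem SearchInv.singleton {V : Type u} {r : V → V → Prop} {S H : Finset V} (hH : H ⊆ S)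
    (hm : Meets r S H) : SearchInv r S 1 H fun v => {v} :=
  ⟨hH, hm, fun h hh => ⟨by simp, by simpa using hH hh, fun D _ hD => by simpa using hD, by simp⟩⟩

section Search

variable {V : Type u} [Fintype V] [DecidableEq V] {G : Digraph V} [DecidableRel G.Adj]

/-- One half of a round of the lock-step search. -/
theorem sat_lockStep_half {α : Type u} {r : V → V → Prop} {op : Finset V → SymProg V (Finset V)}
    (hop : ∀ (Z : Finset V) (Q : Finset V → ℕ → Prop),
      (∀ P : Finset V, (∀ v, v ∈ P ↔ ∃ w ∈ Z, r v w) → Q P 1) → Sat G (op Z) Q)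
    (res : Finset V → Finset V → α) {S H : Finset V} {C : V → Finset V} {ρ : ℕ}
    (hI : SearchInv r S ρ H C) :
    Sat G (forEach H (H, C) (fun h (s : Finset V × (V → Finset V)) => do
      let (H', CH) := s
      let P ← op (CH h)
      let C' := (CH h ∪ P) ∩ S
      if 1 < (C' ∩ H').card then return Sum.inl (H'.erase h, CH)
      else if C' = CH h then return Sum.inr (res (CH h) H')
      else return Sum.inl (H', Function.update CH h C')))
    fun x t => t ≤ H.card ∧ Sum.elim (fun s' => s'.1 ⊆ H ∧ SearchInv r S (ρ + 1) s'.1 s'.2)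
      (fun a => ∃ D H', a = res D H' ∧ H' ⊆ H ∧ Meets r S H' ∧ ClosedIn r S D ∧
        StronglyConn r D) x := by
  refine sat_forEach (fun R s t => R ⊆ s.1 ∧ s.1 ⊆ H ∧ t + R.card ≤ H.card ∧
    SearchInv r S ρ s.1 s.2 ∧ ∀ h ∈ s.1, h ∉ R → ρ + 1 ≤ (s.2 h).card) ?_ ?_ ?_
  · exact ⟨subset_rfl, subset_rfl, by simp, hI, fun h hh hn => absurd hh hn⟩
  · rintro R ⟨H', CH⟩ t ⟨h1, h2, h3, ⟨h4, h5, h6⟩, h7⟩ h hR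
    dsimp only at h1 h2 h3 h4 h5 h6 h7 ⊢
    refine sat_bind (hop _ _ fun P hP => ?_)
    have hH' := h1 hR
    obtain ⟨g1, g2, g3, g4⟩ := h6 h hH'
    have hcard := Finset.card_erase_lt_of_mem hR
    have hC' : ∀ D, ClosedIn r S D → h ∈ D → (CH h ∪ P) ∩ S ⊆ D := by
      intro D hD hh v hv
      have hsub := g3 D hD hh
      rw [Finset.mem_inter, Finset.mem_union, hP] at hv
      rcases hv.1 with hv' | ⟨w, hw, hvw⟩
      exacts [hsub hv', hD.2 v hv.2 w (hsub hw) hvw]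
    have hsub : CH h ⊆ (CH h ∪ P) ∩ S := Finset.subset_inter Finset.subset_union_left g2
    have hhC : h ∈ ((CH h ∪ P) ∩ S) ∩ H' := Finset.mem_inter.2 ⟨hsub g1, hH'⟩
    split_ifs with hc he
    · refine sat_pure ⟨Finset.erase_subset_erase h h1, (Finset.erase_subset h H').trans h2,
        by omega, ⟨(Finset.erase_subset h H').trans h4, fun D hD hne => ?_, fun x hx =>
        h6 x (Finset.mem_of_mem_erase hx)⟩, fun x hx hxR => ?_⟩
      -- Any closed set containing `h` contains `C'`, and so a second element of the current `H'`:
      -- `h` is dispensable. Testing against the current `H'` prevents two start vertices from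
      -- eliminating each other.
      · obtain ⟨x, hx, hxD⟩ := h5 D hD hne
        by_cases hxh : x = h
        · subst hxh
          obtain ⟨y, hy, hyx⟩ := Finset.exists_mem_ne hc x
          rw [Finset.mem_inter] at hy
          exact ⟨y, Finset.mem_erase.2 ⟨hyx, hy.2⟩, hC' D hD hxD hy.1⟩
        · exact ⟨x, Finset.mem_erase.2 ⟨hxh, hx⟩, hxD⟩
      · rw [Finset.mem_erase] at hx
        exact h7 x hx.2 fun hxR' => hxR (Finset.mem_erase.2 ⟨hx.1, hxR'⟩)
    · have hcl : ClosedIn r S (CH h) := by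
        refine ⟨g2, fun v hv w hw hvw => ?_⟩
        rw [← he]
        exact Finset.mem_inter.2 ⟨Finset.mem_union_right _ ((hP v).2 ⟨w, hw, hvw⟩), hv⟩
      refine sat_pure ⟨by omega, _, _, rfl, h2, h5, hcl, ⟨h, g1⟩, fun D hD hne => ?_⟩
      -- A nonempty closed part of `CH h` contains a start vertex, which can only be `h`; it then
      -- contains everything reached from `h`.
      obtain ⟨x, hx, hxD⟩ := h5 D (hcl.trans hD) hne
      have hxh : x = h := Finset.card_le_one.1 (not_lt.1 hc) x
        (Finset.mem_inter.2 ⟨hsub (hD.1 hxD), hx⟩) h hhC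
      subst hxh
      exact hD.1.antisymm (g3 D (hcl.trans hD) hxD)
    · have hlt : (CH h).card < ((CH h ∪ P) ∩ S).card :=
        Finset.card_lt_card (Finset.ssubset_iff_subset_ne.2 ⟨hsub, fun h => he h.symm⟩)
      refine sat_pure ⟨(Finset.erase_subset h R).trans h1, h2, by omega, ⟨h4, h5, ?_⟩, ?_⟩
      · intro x hx
        by_cases hxh : x = h
        · subst hxh
          dsimp only
          rw [Function.update_self]
          exact ⟨hsub g1, Finset.inter_subset_right, hC', by omega⟩
        · dsimp only
          rw [Function.update_of_ne hxh]
          exact h6 x hx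
      · intro x hx hxR
        by_cases hxh : x = h
        · subst hxh
          dsimp only
          rw [Function.update_self]
          omega
        · dsimp only
          rw [Function.update_of_ne hxh]
          exact h7 x hx fun hxR' => hxR (Finset.mem_erase.2 ⟨hxh, hxR'⟩)
  · rintro ⟨H', CH⟩ t ⟨-, h2, h3, h4, h7⟩
    refine ⟨by simpa using h3, h2, h4.1, h4.2.1, fun h hh => ?_⟩
    obtain ⟨g1, g2, g3, -⟩ := h4.2.2 h hh
    exact ⟨g1, g2, g3, h7 h hh (Finset.notMem_empty h)⟩

/-- Lock-step search finds a strongly connected set `C` that is closed in `S` in one direction, and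
the number of its rounds is at most the size of `C`, and at most the size of `S \ C` if `C ≠ S`. -/
theorem sat_lockStepSearch {S H T : Finset V} (hS : S.Nonempty) (hH : H ⊆ S) (hT : T ⊆ S)
    (hmH : Meets G.Adj S H) (hmT : Meets (flip G.Adj) S T) :
    Sat G (lockStepSearch S H T) fun x t =>
      (ClosedIn G.Adj S x.1 ∨ ClosedIn (flip G.Adj) S x.1) ∧ StronglyConn G.Adj x.1 ∧
      x.2.1 ⊆ H ∧ x.2.2 ⊆ T ∧ Meets G.Adj S x.2.1 ∧ Meets (flip G.Adj) S x.2.2 ∧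
      ∃ ρ, t ≤ ρ * (H.card + T.card) ∧ ρ ≤ x.1.card ∧ (x.1 ≠ S → ρ ≤ (S \ x.1).card) := by
  have hSS : ClosedIn G.Adj S S := ⟨subset_rfl, fun v hv _ _ _ => hv⟩
  refine sat_loop (fun k st t => st.1 ⊆ H ∧ st.2.1 ⊆ T ∧ ∃ ρ, k + ρ = S.card ∧
    t ≤ ρ * (H.card + T.card) ∧ SearchInv G.Adj S (ρ + 1) st.1 st.2.2.1 ∧
    SearchInv (flip G.Adj) S (ρ + 1) st.2.1 st.2.2.2) S.card
    ⟨subset_rfl, subset_rfl, 0, rfl, by simp, SearchInv.singleton hH hmH,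
      SearchInv.singleton hT hmT⟩ ?_
  rintro k ⟨H₁, T₁, CH, CT⟩ t ⟨hH₁, hT₁, ρ, hk, ht, hIH, hIT⟩
  dsimp only at hH₁ hT₁ ht hIH hIT ⊢
  have c1 := Finset.card_le_card hH₁
  have c2 := Finset.card_le_card hT₁
  refine sat_bind ((sat_lockStep_half (α := Finset V × Finset V × Finset V)
    (fun Z Q h => sat_pre (h _ fun v => mem_preSet)) (fun D H' => (D, H', T₁)) hIH).mono ?_)
  rintro (⟨H', CH'⟩ | res) t₁ ⟨ht₁, h⟩
  · obtain ⟨hH', hIH'⟩ := h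
    dsimp only at hH' hIH' ⊢
    refine sat_bind ((sat_lockStep_half (α := Finset V × Finset V × Finset V)
      (fun Z Q h => sat_post (h _ fun v => mem_postSet)) (fun D T' => (D, H', T')) hIT).mono ?_)
    rintro (⟨T', CT'⟩ | res) t₂ ⟨ht₂, h⟩
    · obtain ⟨hT', hIT'⟩ := h
      dsimp only at hT' hIT' ⊢
      have := hIH'.le_card hSS hS
      refine sat_pure ⟨S.card - (ρ + 1), by omega, hH'.trans hH₁, hT'.trans hT₁, ρ + 1, by omega,
        ?_, hIH', hIT'⟩
      rw [add_mul]
      omega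
    · obtain ⟨D, T', rfl, hT', hmT', hcl, hsc⟩ := h
      -- The set found is successor-closed, so its complement is predecessor-closed, and the
      -- backward searches bound the size of the complement from below.
      refine sat_pure ⟨Or.inr hcl, hsc.flip, hH'.trans hH₁, hT'.trans hT₁, hIH'.2.1, hmT', ρ + 1,
        ?_, hIT.le_card hcl hsc.1, fun hne => hIH.le_card hcl.compl ?_⟩
      · rw [add_mul]
        omega
      · rw [Finset.sdiff_nonempty]
        exact fun hs => hne (hcl.1.antisymm hs)
  · obtain ⟨D, H', rfl, hH', hmH', hcl, hsc⟩ := h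
    refine sat_pure ⟨Or.inl hcl, hsc, hH'.trans hH₁, hT₁, hmH', hIT.2.1, ρ + 1,
      ?_, hIH.le_card hcl hsc.1, fun hne => hIT.le_card hcl.compl ?_⟩
    · rw [add_mul]
      omega
    · rw [Finset.sdiff_nonempty]
      exact fun hs => hne (hcl.1.antisymm hs)

end Search

/-! ### Candidates and the removal of bad vertices -/

/-- The edges that lead from `X` to `Y`. -/
def Digraph.edgesBetween {V : Type u} [Fintype V] [DecidableEq V] (G : Digraph V)
    [DecidableRel G.Adj] (X Y : Finset V) : Finset (V × V) :=
  {e : V × V | G.Adj e.1 e.2 ∧ e.1 ∈ X ∧ e.2 ∈ Y}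

/-- The number of the edges within `S`, plus the sizes of `H` and `T`. -/
def candWeight {V : Type u} [Fintype V] [DecidableEq V] (G : Digraph V)
    [DecidableRel G.Adj] (c : Finset V × Finset V × Finset V) : ℕ :=
  (G.edgesBetween c.1 c.1).card + c.2.1.card + c.2.2.card

/-- The invariant of the candidates. -/
def IsCandidate {V : Type u} (G : Digraph V) (S H T : Finset V) : Prop :=
  H ⊆ S ∧ T ⊆ S ∧
    ((StronglyConn G.Adj S ∧ H = ∅ ∧ T = ∅) ∨ (Meets G.Adj S H ∧ Meets (flip G.Adj) S T))

/-- `I` is a strongly connected set with an edge and without bad vertices. -/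
def IsGoodComp {V : Type u} [Fintype V] [DecidableEq V] (G : Digraph V) [DecidableRel G.Adj]
    {k : ℕ} (L U : Fin k → Finset V) (I : Finset V) : Prop :=
  StronglyConn G.Adj I ∧ G.postSet I ∩ I ≠ ∅ ∧ badVertices L U I = ∅

theorem mem_badVertices {V : Type u} [DecidableEq V] {k : ℕ} {L U : Fin k → Finset V}
    {S : Finset V} {v : V} :
    v ∈ badVertices L U S ↔ ∃ i, U i ∩ S = ∅ ∧ v ∈ L i ∧ v ∈ S := by
  simp [badVertices]

theorem IsSCCs.sum_card_le {V : Type u} [DecidableEq V] {G : Digraph V} {A : Finset V}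
    {F : Finset (Finset V)} (hF : IsSCCs G A F) :
    ∑ D ∈ F, D.card ≤ A.card := by
  have := Finset.card_biUnion (s := F) (t := id) hF.2.1
  simp only [id] at this
  rw [← this]
  exact Finset.card_le_card (Finset.biUnion_subset.2 fun D hD => (hF.1 D hD).2)

theorem IsSCCs.eq_of_card_eq_one {V : Type u} {G : Digraph V} {A : Finset V} {F : Finset (Finset V)}
    (hF : IsSCCs G A F) (h : F.card = 1) : StronglyConn G.Adj A := by
  obtain ⟨D, rfl⟩ := Finset.card_eq_one.1 h
  obtain ⟨h1, h2⟩ := hF.1 D (Finset.mem_singleton_self D)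
  have : D = A := by
    refine h2.antisymm fun v hv => ?_
    obtain ⟨D', hD', hv'⟩ := hF.2.2 {v} (by simpa using hv) (stronglyConn_singleton _ v)
    rw [Finset.mem_singleton] at hD'
    subst hD'
    simpa using hv'
  rwa [← this]

theorem IsSCCs.nonempty {V : Type u} {G : Digraph V} {A : Finset V} {F : Finset (Finset V)}
    (hF : IsSCCs G A F) (hA : A.Nonempty) : F.Nonempty := by
  obtain ⟨v, hv⟩ := hA
  obtain ⟨D, hD, -⟩ := hF.2.2 {v} (by simpa using hv) (stronglyConn_singleton _ v)
  exact ⟨D, hD⟩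

/-- A subset of `S \ B` that is closed there but not in `S` receives an edge from `B`, whose head is
in `P`. One that is closed in `S` already meets `H`, or would equal `S` if `S` is strongly
connected. -/
theorem Meets.sdiff {V : Type u} [DecidableEq V] {r : V → V → Prop} {S H B P : Finset V}
    (h : StronglyConn r S ∨ Meets r S H) (hBS : B ⊆ S) (hB : B.Nonempty)
    (hP : ∀ v, v ∈ P ↔ ∃ w ∈ B, r w v) : Meets r (S \ B) ((H ∪ P) ∩ (S \ B)) := by
  intro D hD hne
  simp only [Finset.mem_inter, Finset.mem_union, hP]
  by_cases hcl : ClosedIn r S D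
  · rcases h with h | h
    · obtain ⟨x, hx⟩ := hB
      have := h.2 D hcl hne
      rw [this] at hD
      exact absurd hx (Finset.mem_sdiff.1 (hD.1 (hBS hx))).2
    · obtain ⟨x, hx, hxD⟩ := h D hcl hne
      exact ⟨x, ⟨Or.inl hx, hD.1 hxD⟩, hxD⟩
  · have hDS := hD.1.trans Finset.sdiff_subset
    simp only [ClosedIn, hDS, true_and, not_forall] at hcl
    obtain ⟨v, hv, w, hw, hvw, hvD⟩ := hcl
    refine ⟨w, ⟨Or.inr ⟨v, ?_, hvw⟩, hD.1 hw⟩, hw⟩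
    by_contra hvB
    exact hvD (hD.2 v (Finset.mem_sdiff.2 ⟨hv, hvB⟩) w hw hvw)

theorem StronglyConn.isCandidate {V : Type u} {G : Digraph V} {C : Finset V}
    (h : StronglyConn G.Adj C) :
    IsCandidate G C ∅ ∅ :=
  ⟨Finset.empty_subset C, Finset.empty_subset C, Or.inl ⟨h, rfl, rfl⟩⟩

section Candidates

variable {V : Type u} [Fintype V] [DecidableEq V] {G : Digraph V} [DecidableRel G.Adj]

theorem mem_edgesBetween {X Y : Finset V} {e : V × V} :
    e ∈ G.edgesBetween X Y ↔ G.Adj e.1 e.2 ∧ e.1 ∈ X ∧ e.2 ∈ Y := by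
  simp [Digraph.edgesBetween]

theorem edgesBetween_univ : (G.edgesBetween Finset.univ Finset.univ).card = G.numEdges := by
  simp [Digraph.edgesBetween, Digraph.numEdges]

/-- Each vertex of `Post(B)` or `Pre(B)` in `S \ B` is charged to an edge between `B` and `S \ B`.
These edges are disjoint from those inside either part. -/
theorem card_edgesBetween_split {S B : Finset V} (hB : B ⊆ S) :
    (G.edgesBetween B B).card + (G.edgesBetween (S \ B) (S \ B)).card +
      (G.postSet B ∩ (S \ B)).card + (G.preSet B ∩ (S \ B)).card ≤
      (G.edgesBetween S S).card := by
  have h1 : (G.postSet B ∩ (S \ B)).card ≤ (G.edgesBetween B (S \ B)).card := by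
    refine (Finset.card_le_card (t := (G.edgesBetween B (S \ B)).image Prod.snd) ?_).trans
      Finset.card_image_le
    intro v hv
    rw [Finset.mem_inter, mem_postSet] at hv
    obtain ⟨⟨w, hw, hwv⟩, hvS⟩ := hv
    exact Finset.mem_image.2 ⟨(w, v), mem_edgesBetween.2 ⟨hwv, hw, hvS⟩, rfl⟩
  have h2 : (G.preSet B ∩ (S \ B)).card ≤ (G.edgesBetween (S \ B) B).card := by
    refine (Finset.card_le_card (t := (G.edgesBetween (S \ B) B).image Prod.fst) ?_).trans
      Finset.card_image_le
    intro v hv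
    rw [Finset.mem_inter, mem_preSet] at hv
    obtain ⟨⟨w, hw, hvw⟩, hvS⟩ := hv
    exact Finset.mem_image.2 ⟨(v, w), mem_edgesBetween.2 ⟨hvw, hvS, hw⟩, rfl⟩
  have h3 : ((G.edgesBetween B B ∪ G.edgesBetween (S \ B) (S \ B)) ∪
      (G.edgesBetween B (S \ B) ∪ G.edgesBetween (S \ B) B)).card ≤
      (G.edgesBetween S S).card := by
    refine Finset.card_le_card fun e he => ?_
    simp only [Finset.mem_union, mem_edgesBetween, Finset.mem_sdiff] at he ⊢
    have := @hB e.1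
    have := @hB e.2
    tauto
  rw [Finset.card_union_of_disjoint, Finset.card_union_of_disjoint,
    Finset.card_union_of_disjoint] at h3
  · omega
  all_goals
    rw [Finset.disjoint_left]
    intro e
    simp only [Finset.mem_union, mem_edgesBetween, Finset.mem_sdiff]
    tauto

theorem candWeight_split {S H T C : Finset V} (hC : C ⊆ S) :
    candWeight G (C, ∅, ∅) + candWeight G
      (S \ C, (H ∪ G.postSet C) ∩ (S \ C), (T ∪ G.preSet C) ∩ (S \ C)) ≤
      candWeight G (S, H, T) := by
  have h := card_edgesBetween_split (G := G) hC
  have h1 : ((H ∪ G.postSet C) ∩ (S \ C)).card ≤ H.card + (G.postSet C ∩ (S \ C)).card := by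
    rw [Finset.union_inter_distrib_right]
    exact (Finset.card_union_le _ _).trans
      (Nat.add_le_add_right (Finset.card_le_card Finset.inter_subset_left) _)
  have h2 : ((T ∪ G.preSet C) ∩ (S \ C)).card ≤ T.card + (G.preSet C ∩ (S \ C)).card := by
    rw [Finset.union_inter_distrib_right]
    exact (Finset.card_union_le _ _).trans
      (Nat.add_le_add_right (Finset.card_le_card Finset.inter_subset_left) _)
  simp only [candWeight, Finset.card_empty]
  omega

theorem IsSCCs.sum_edges_le {A : Finset V} {F : Finset (Finset V)} (hF : IsSCCs G A F) :
    ∑ D ∈ F, (G.edgesBetween D D).card ≤ (G.edgesBetween A A).card := by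
  rw [← Finset.card_biUnion]
  · refine Finset.card_le_card (Finset.biUnion_subset.2 fun D hD e he => ?_)
    have hDA := (hF.1 D hD).2
    rw [mem_edgesBetween] at he ⊢
    exact ⟨he.1, hDA he.2.1, hDA he.2.2⟩
  · intro D hD D' hD' hne
    have hdis : Disjoint D D' := hF.2.1 hD hD' hne
    refine Finset.disjoint_left.2 fun e he he' => ?_
    rw [mem_edgesBetween] at he he'
    exact Finset.disjoint_left.1 hdis he.2.1 he'.2.1

theorem IsCandidate.sdiff {S H T B : Finset V}
    (h : StronglyConn G.Adj S ∨ (Meets G.Adj S H ∧ Meets (flip G.Adj) S T))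
    (hBS : B ⊆ S) (hB : B.Nonempty) :
    IsCandidate G (S \ B) ((H ∪ G.postSet B) ∩ (S \ B)) ((T ∪ G.preSet B) ∩ (S \ B)) :=
  ⟨Finset.inter_subset_right, Finset.inter_subset_right, Or.inr
    ⟨Meets.sdiff (h.imp_right And.left) hBS hB fun _ => mem_postSet,
      Meets.sdiff (h.imp StronglyConn.flip And.right) hBS hB fun _ => mem_preSet⟩⟩

/-- If `U i` misses `S`, it misses the subset `I`, so a vertex of `I` that is bad in `S` would be
bad in `I`. -/
theorem IsGoodComp.subset_sdiff_badVertices {k : ℕ} {L U : Fin k → Finset V} {I S : Finset V}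
    (hI : IsGoodComp G L U I) (hIS : I ⊆ S) : I ⊆ S \ badVertices L U S := by
  intro v hv
  rw [Finset.mem_sdiff, mem_badVertices]
  refine ⟨hIS hv, ?_⟩
  rintro ⟨i, hU, hvL, -⟩
  have : v ∈ badVertices L U I := mem_badVertices.2 ⟨i, Finset.subset_empty.1
    ((Finset.inter_subset_inter_left hIS).trans hU.subset), hvL, hv⟩
  rw [hI.2.2] at this
  exact Finset.notMem_empty v this

/-- Each round costs two steps and deletes at least one vertex; the growth of `H` and `T` is charged
to cut edges. -/
theorem sat_removeBad {k : ℕ} (L U : Fin k → Finset V) {S H T : Finset V}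
    (hc : IsCandidate G S H T) :
    Sat G (removeBad L U (S, H, T)) fun c t => IsCandidate G c.1 c.2.1 c.2.2 ∧ c.1 ⊆ S ∧
      t + 2 * c.1.card ≤ 2 * S.card ∧ candWeight G c ≤ candWeight G (S, H, T) ∧
      badVertices L U c.1 = ∅ ∧ ∀ I ⊆ S, IsGoodComp G L U I → I ⊆ c.1 := by
  refine sat_loop (fun k c t => k = c.1.card ∧ IsCandidate G c.1 c.2.1 c.2.2 ∧ c.1 ⊆ S ∧
      t + 2 * c.1.card ≤ 2 * S.card ∧ candWeight G c ≤ candWeight G (S, H, T) ∧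
      ∀ I ⊆ S, IsGoodComp G L U I → I ⊆ c.1) S.card
    ⟨rfl, hc, subset_rfl, by simp, le_rfl, fun I hI _ => hI⟩ ?_
  rintro k ⟨S', H', T'⟩ t ⟨rfl, h1, h2, h3, h4, h5⟩
  dsimp only at h1 h2 h3 h4 h5 ⊢
  have hsub : badVertices L U S' ⊆ S' := fun v hv => (mem_badVertices.1 hv).choose_spec.2.2
  split_ifs with hB
  · exact sat_pure ⟨h1, h2, h3, h4, hB, h5⟩
  · refine sat_bind (sat_post (sat_bind (sat_pre (sat_pure ?_))))
    have hne := Finset.nonempty_iff_ne_empty.2 hB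
    have c1 := Finset.card_sdiff_add_card_eq_card hsub
    have c2 := hne.card_pos
    have hw := candWeight_split (G := G) (H := H') (T := T') hsub
    refine ⟨(S' \ badVertices L U S').card, by omega, rfl,
      IsCandidate.sdiff (h1.2.2.imp_left And.left) hsub hne,
      Finset.sdiff_subset.trans h2, ?_, ?_, fun I hI hIg => ?_⟩
    · dsimp only
      omega
    · omega
    · exact hIg.subset_sdiff_badVertices (h5 I hI hIg)

end Candidates

/-! ### Good components and winning plays -/

section Walks

variable {V : Type u} {r : V → V → Prop}

theorem exists_walk_append {p q : ℕ} {f g : ℕ → V} (hfg : f p = g 0)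
    (hf : ∀ i < p, r (f i) (f (i + 1))) (hg : ∀ i < q, r (g i) (g (i + 1))) :
    ∃ h : ℕ → V, (∀ i ≤ p, h i = f i) ∧ (∀ i, h (p + i) = g i) ∧
      ∀ i < p + q, r (h i) (h (i + 1)) := by
  obtain ⟨h, h1, h2⟩ : ∃ h : ℕ → V, (∀ i ≤ p, h i = f i) ∧ ∀ i, h (p + i) = g i := by
    refine ⟨fun i => if i ≤ p then f i else g (i - p), fun i hi => by simp [hi], fun i => ?_⟩
    rcases Nat.eq_zero_or_pos i with rfl | hi
    · simp [hfg]
    · have : ¬p + i ≤ p := by omega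
      simp [this]
  refine ⟨h, h1, h2, fun i hi => ?_⟩
  by_cases hip : i < p
  · rw [h1 i hip.le, h1 (i + 1) hip]
    exact hf i hip
  · obtain ⟨j, rfl⟩ := Nat.exists_eq_add_of_le (not_lt.1 hip)
    rw [add_assoc, h2, h2]
    exact hg j (by omega)

theorem Relation.TransGen.exists_walk {x y : V} (h : Relation.TransGen r x y) :
    ∃ (p : ℕ) (f : ℕ → V), 0 < p ∧ f 0 = x ∧ f p = y ∧ ∀ i < p, r (f i) (f (i + 1)) := by
  induction h with
  | @single y h =>
    refine ⟨1, fun i => if i = 0 then x else y, one_pos, by simp, by simp, fun i hi => ?_⟩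
    obtain rfl : i = 0 := by omega
    simpa using h
  | @tail y z _ h ih =>
    obtain ⟨p, f, hp, h0, hpy, hf⟩ := ih
    obtain ⟨g, h1, h2, h3⟩ := exists_walk_append (q := 1)
      (g := fun i => if i = 0 then y else z) (by simpa using hpy) hf (fun i hi => by
        obtain rfl : i = 0 := by omega
        simpa using h)
    refine ⟨p + 1, g, by omega, by rw [h1 0 (Nat.zero_le p), h0], ?_, h3⟩
    rw [h2 1]
    simp

/-- For each further vertex of `F`, a round trip from `x` is appended. `F` is separate from `S` so
that the induction keeps all connecting walks available. -/
theorem exists_closed_walk [DecidableEq V] {S : Finset V}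
    (h : ∀ x ∈ S, ∀ y ∈ S, Relation.TransGen r x y) {x : V} (hx : x ∈ S) (F : Finset V)
    (hF : F ⊆ S) : ∃ (p : ℕ) (f : ℕ → V), 0 < p ∧ f 0 = x ∧ f p = x ∧
      (∀ i < p, r (f i) (f (i + 1))) ∧ ∀ v ∈ F, ∃ i < p, f i = v := by
  induction F using Finset.induction_on with
  | empty =>
    obtain ⟨p, f, hp, h0, hpx, hf⟩ := (h x hx x hx).exists_walk
    exact ⟨p, f, hp, h0, hpx, hf, by simp⟩
  | insert y F _ ih =>
    obtain ⟨p, f, hp, h0, hpx, hf, hcov⟩ := ih fun v hv => hF (Finset.mem_insert_of_mem hv)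
    have hy := hF (Finset.mem_insert_self y F)
    obtain ⟨q, g, hq, g0, gq, hg⟩ := (h x hx y hy).exists_walk
    obtain ⟨q', g', hq', g0', gq', hg'⟩ := (h y hy x hx).exists_walk
    obtain ⟨w, w1, w2, w3⟩ := exists_walk_append (gq.trans g0'.symm) hg hg'
    obtain ⟨u, u1, u2, u3⟩ := exists_walk_append
      (hpx.trans (g0.symm.trans (w1 0 (Nat.zero_le q)).symm)) hf w3
    refine ⟨p + (q + q'), u, by omega, by rw [u1 0 (Nat.zero_le p), h0],
      by rw [u2, w2, gq'], u3, fun v hv => ?_⟩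
    rcases Finset.mem_insert.1 hv with rfl | hv
    · exact ⟨p + q, by omega, by rw [u2, w1 q le_rfl, gq]⟩
    · obtain ⟨i, hi, rfl⟩ := hcov v hv
      exact ⟨i, by omega, u1 i hi.le⟩

end Walks

section Streett

variable {V : Type u} {G : Digraph V} {k : ℕ} {L U : Fin k → Finset V}

theorem winningSet_of_adj {v w : V} (h : G.Adj v w)
    (hw : w ∈ winningSet (streettObjective G L U)) :
    v ∈ winningSet (streettObjective G L U) := by
  obtain ⟨π, ⟨hplay, hstr⟩, rfl⟩ := hw
  have hinf : infOcc (fun i => Nat.casesOn i v π) = infOcc π := by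
    ext x
    constructor
    · intro hx i
      obtain ⟨j, hij, hj⟩ := hx (i + 1)
      obtain ⟨j, rfl⟩ : ∃ j', j = j' + 1 := ⟨j - 1, by omega⟩
      exact ⟨j, by omega, hj⟩
    · intro hx i
      obtain ⟨j, hij, hj⟩ := hx i
      exact ⟨j + 1, by omega, hj⟩
  refine ⟨fun i => Nat.casesOn i v π, ⟨?_, ?_⟩, rfl⟩
  · intro i
    cases i with
    | zero => exact h
    | succ i => exact hplay i
  · rw [hinf]
    exact hstr

variable [Fintype V] [DecidableEq V] [DecidableRel G.Adj]

/-- For an edge from `a` to `b` inside `S`, the vertices with a walk of positive length to `b` form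
a nonempty closed set, hence all of `S`; dually for the walks from `b`. The relation records `a ∈ S`
to keep walks inside `S`. -/
theorem IsGoodComp.transGen {S : Finset V} (hS : IsGoodComp G L U S) :
    ∀ x ∈ S, ∀ y ∈ S, Relation.TransGen (fun a b => G.Adj a b ∧ a ∈ S) x y := by
  classical
  obtain ⟨b, hb⟩ := Finset.nonempty_iff_ne_empty.2 hS.2.1
  rw [Finset.mem_inter, mem_postSet] at hb
  obtain ⟨⟨a, ha, hab⟩, hb⟩ := hb
  have h1 : {z ∈ S | Relation.TransGen (fun a b => G.Adj a b ∧ a ∈ S) z b} = S := by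
    refine hS.1.2 _ ⟨Finset.filter_subset _ _, fun v hv w hw hvw => ?_⟩
      ⟨a, Finset.mem_filter.2 ⟨ha, .single ⟨hab, ha⟩⟩⟩
    rw [Finset.mem_filter] at hw ⊢
    exact ⟨hv, .head ⟨hvw, hv⟩ hw.2⟩
  rw [Finset.filter_eq_self] at h1
  have h2 : {z ∈ S | Relation.TransGen (fun a b => G.Adj a b ∧ a ∈ S) b z} = S := by
    refine hS.1.flip.2 _ ⟨Finset.filter_subset _ _, fun v hv w hw hvw => ?_⟩
      ⟨b, Finset.mem_filter.2 ⟨hb, h1 b hb⟩⟩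
    rw [Finset.mem_filter] at hw ⊢
    exact ⟨hv, hw.2.tail ⟨hvw, hw.1⟩⟩
  rw [Finset.filter_eq_self] at h2
  exact fun x hx y hy => (h1 x hx).trans (h2 y hy)

/-- Repeating a closed walk through all of `S` forever visits exactly the vertices of `S` infinitely
often. -/
theorem IsGoodComp.mem_winningSet {S : Finset V} (hS : IsGoodComp G L U S) {x : V}
    (hx : x ∈ S) : x ∈ winningSet (streettObjective G L U) := by
  obtain ⟨p, f, hp, h0, hpx, hf, hcov⟩ := exists_closed_walk hS.transGen hx S subset_rfl
  have hinf : infOcc (fun i => f (i % p)) = S := by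
    ext v
    constructor
    · intro hv
      obtain ⟨j, -, rfl⟩ := hv 0
      exact (hf (j % p) (Nat.mod_lt j hp)).2
    · intro hv i
      obtain ⟨j, hj, rfl⟩ := hcov v hv
      refine ⟨j + p * i, (Nat.le_mul_of_pos_left i hp).trans (Nat.le_add_left _ _), ?_⟩
      dsimp only
      rw [Nat.add_mul_mod_self_left, Nat.mod_eq_of_lt hj]
  refine ⟨fun i => f (i % p), ⟨fun i => ?_, fun i => ?_⟩, by simpa using h0⟩
  · have hlt := Nat.mod_lt i hp
    have := (hf (i % p) hlt).1
    rcases Nat.lt_or_ge (i % p + 1) p with h | h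
    · rwa [← Nat.mod_eq_of_lt h, Nat.mod_add_mod] at this
    · have he : i % p + 1 = p := by omega
      rw [he, hpx, ← h0] at this
      dsimp only
      rwa [← Nat.mod_add_mod, he, Nat.mod_self]
  · rw [hinf]
    by_cases hU : U i ∩ S = ∅
    · left
      rw [← Finset.coe_inter, Finset.coe_eq_empty, Finset.eq_empty_iff_forall_notMem]
      intro v hv
      rw [Finset.mem_inter] at hv
      have : v ∈ badVertices L U S := mem_badVertices.2 ⟨i, hU, hv⟩
      rw [hS.2.2] at this
      exact Finset.notMem_empty v this
    · right
      rw [← Finset.coe_inter, Finset.coe_nonempty]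
      exact Finset.nonempty_iff_ne_empty.2 hU

/-- `I` is the set of vertices seen infinitely often. As `V` is finite, the play eventually stays in
`I`, and its segments connect any two vertices of `I`. -/
theorem exists_isGoodComp {π : ℕ → V} (hπ : π ∈ streettObjective G L U) :
    ∃ I, IsGoodComp G L U I ∧ ∃ N, ∀ i, N ≤ i → π i ∈ I := by
  classical
  obtain ⟨hplay, hstr⟩ := hπ
  have hmem : ∀ v, v ∈ ({v : V | v ∈ infOcc π} : Finset V) ↔ v ∈ infOcc π := by simp
  have hcoe : (({v : V | v ∈ infOcc π} : Finset V) : Set V) = infOcc π := by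
    ext v
    simp
  set I : Finset V := {v : V | v ∈ infOcc π}
  obtain ⟨N, hN⟩ : ∃ N, ∀ i, N ≤ i → π i ∈ I := by
    have : ∀ᶠ i in Filter.atTop, ∀ v, v ∉ I → π i ≠ v := by
      rw [Filter.eventually_all]
      intro v
      by_cases hv : v ∈ I
      · simp [hv]
      · have hv' := hv
        simp only [hmem, infOcc, Set.mem_ofPred_eq, not_forall, not_exists, not_and] at hv'
        obtain ⟨i, hi⟩ := hv'
        filter_upwards [Filter.eventually_ge_atTop i] with j hj _ using hi j hj
    obtain ⟨N, hN⟩ := Filter.eventually_atTop.1 this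
    exact ⟨N, fun i hi => by_contra fun h => hN i hi _ h rfl⟩
  refine ⟨I, ⟨⟨⟨π N, hN N le_rfl⟩, fun D hD hne => ?_⟩, ?_, ?_⟩, N, hN⟩
  · refine hD.1.antisymm fun x hx => ?_
    obtain ⟨j, hj, rfl⟩ := (hmem x).1 hx N
    obtain ⟨d, hd⟩ := hne
    obtain ⟨j', hj', rfl⟩ := (hmem d).1 (hD.1 hd) j
    obtain ⟨q, rfl⟩ := Nat.exists_eq_add_of_le hj'
    clear hj' hx
    -- The play leads from `x` to a vertex of `D` in `q` steps within `I`, and `D` is closed under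
    -- predecessors in `I`.
    induction q generalizing j with
    | zero => exact hd
    | succ q ih =>
      refine hD.2 _ (hN j hj) _ (ih (j + 1) (by omega) ?_) (hplay j)
      rwa [add_right_comm]
  · refine Finset.nonempty_iff_ne_empty.1 ⟨π (N + 1), ?_⟩
    rw [Finset.mem_inter, mem_postSet]
    exact ⟨⟨π N, hN N le_rfl, hplay N⟩, hN (N + 1) (by omega)⟩
  · rw [Finset.eq_empty_iff_forall_notMem]
    intro v hv
    obtain ⟨i, hU, hvL, hvI⟩ := mem_badVertices.1 hv
    rw [← Finset.coe_eq_empty, Finset.coe_inter, hcoe] at hU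
    rcases hstr i with h | h
    · exact (Set.eq_empty_iff_forall_notMem.1 h v) ⟨hvL, (hmem v).1 hvI⟩
    · exact h.ne_empty hU

/-- The vertices that can reach a family of good components that covers all good components are the
winning ones. -/
theorem IsClosure.eq_winningSet {W : Finset V} {good : Finset (Finset V)}
    (hW : IsClosure G.Adj Finset.univ (good.biUnion id) W)
    (hgood : ∀ S ∈ good, IsGoodComp G L U S)
    (hcov : ∀ I, IsGoodComp G L U I → ∃ S ∈ good, I ⊆ S) :
    (W : Set V) = winningSet (streettObjective G L U) := by
  classical
  refine Set.Subset.antisymm ?_ ?_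
  · have := hW.2.2 {v : V | v ∈ winningSet (streettObjective G L U)}
      ⟨Finset.subset_univ _, fun v _ w hw hvw => ?_⟩ fun v hv => ?_
    · intro v hv
      simpa using this hv
    · simp only [Finset.mem_filter, Finset.mem_univ, true_and] at hw ⊢
      exact winningSet_of_adj hvw hw
    · simp only [Finset.mem_biUnion, id] at hv
      obtain ⟨S, hS, hv⟩ := hv
      simpa using (hgood S hS).mem_winningSet hv
  · rintro v ⟨π, hπ, rfl⟩
    obtain ⟨I, hI, N, hN⟩ := exists_isGoodComp hπ
    obtain ⟨S, hS, hIS⟩ := hcov I hI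
    have hNW : π N ∈ W := hW.2.1 (Finset.mem_biUnion.2 ⟨S, hS, hIS (hN N le_rfl)⟩)
    clear hN
    induction N with
    | zero => exact hNW
    | succ N ih => exact ih (hW.1.2 _ (Finset.mem_univ _) _ hNW (hπ.1 N))

end Streett

/-! ### The logarithmic potential -/

/-- The potential `s (1 + log₂ s)`, which pays for the rounds of the lock-step searches. -/
noncomputable def splitPotential (s : ℕ) : ℝ := s * (1 + Real.log s / Real.log 2)

section SplitPotential

theorem le_splitPotential (s : ℕ) : (s : ℝ) ≤ splitPotential s := by
  have h2 : 0 ≤ Real.log s / Real.log 2 :=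
    div_nonneg (Real.log_natCast_nonneg s) (Real.log_nonneg one_le_two)
  exact le_mul_of_one_le_right (Nat.cast_nonneg s) (by linarith)

theorem splitPotential_nonneg (s : ℕ) : 0 ≤ splitPotential s :=
  (Nat.cast_nonneg s).trans (le_splitPotential s)

theorem mul_le_splitPotential {a s : ℕ} (ha : 0 < a) (h : a ≤ s) :
    splitPotential a ≤ a * (1 + Real.log s / Real.log 2) := by
  refine mul_le_mul_of_nonneg_left ?_ (Nat.cast_nonneg a)
  have : Real.log a ≤ Real.log s :=
    Real.log_le_log (by exact_mod_cast ha) (by exact_mod_cast h)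
  have := div_le_div_of_nonneg_right this (Real.log_nonneg one_le_two)
  linarith

theorem one_add_log_nonneg (s : ℕ) : 0 ≤ 1 + Real.log s / Real.log 2 := by
  have : 0 ≤ Real.log s / Real.log 2 :=
    div_nonneg (Real.log_natCast_nonneg s) (Real.log_nonneg one_le_two)
  linarith

theorem splitPotential_mono {a s : ℕ} (ha : 0 < a) (h : a ≤ s) :
    splitPotential a ≤ splitPotential s :=
  (mul_le_splitPotential ha h).trans
    (mul_le_mul_of_nonneg_right (by exact_mod_cast h) (one_add_log_nonneg s))

/-- The smaller part has at most half the vertices, so the logarithm drops by at least one for each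
of its `a` vertices. -/
theorem splitPotential_add_of_le {a b : ℕ} (ha : 0 < a) (hab : a ≤ b) :
    splitPotential a + splitPotential b + a ≤ splitPotential (a + b) := by
  have h2 : 0 < Real.log 2 := Real.log_pos one_lt_two
  have hb := mul_le_splitPotential (ha.trans_le hab) (Nat.le_add_left b a)
  have h3 : Real.log a + Real.log 2 ≤ Real.log ((a + b : ℕ) : ℝ) := by
    have ha' : (0 : ℝ) < a := by exact_mod_cast ha
    rw [← Real.log_mul ha'.ne' two_ne_zero]
    refine Real.log_le_log (by positivity) ?_
    have : (a : ℝ) ≤ b := by exact_mod_cast hab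
    push_cast
    linarith
  have h4 : Real.log a / Real.log 2 + 1 ≤ Real.log ((a + b : ℕ) : ℝ) / Real.log 2 := by
    rw [le_div_iff₀ h2, add_mul, div_mul_cancel₀ _ h2.ne', one_mul]
    exact h3
  have h5 := mul_le_mul_of_nonneg_left h4 (Nat.cast_nonneg a)
  have h6 : splitPotential (a + b) = a * (1 + Real.log ((a + b : ℕ) : ℝ) / Real.log 2) +
      b * (1 + Real.log ((a + b : ℕ) : ℝ) / Real.log 2) := by
    rw [splitPotential, ← add_mul, Nat.cast_add]
  rw [h6]
  have h7 : splitPotential a = a * (1 + Real.log a / Real.log 2) := rfl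
  linarith

theorem splitPotential_add {a b r : ℕ} (ha : 0 < a) (hb : 0 < b) (hra : r ≤ a) (hrb : r ≤ b) :
    splitPotential a + splitPotential b + r ≤ splitPotential (a + b) := by
  have hra' : (r : ℝ) ≤ a := by exact_mod_cast hra
  have hrb' : (r : ℝ) ≤ b := by exact_mod_cast hrb
  rcases le_total a b with h | h
  · linarith [splitPotential_add_of_le ha h]
  · have := splitPotential_add_of_le hb h
    rw [add_comm b a] at this
    linarith

theorem IsSCCs.sum_splitPotential_le {V : Type u} [DecidableEq V] {G : Digraph V} {A : Finset V}
    {F : Finset (Finset V)} (hF : IsSCCs G A F) :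
    ∑ D ∈ F, splitPotential D.card ≤ splitPotential A.card := by
  calc ∑ D ∈ F, splitPotential D.card
      ≤ ∑ D ∈ F, D.card * (1 + Real.log A.card / Real.log 2) :=
        Finset.sum_le_sum fun D hD => mul_le_splitPotential (hF.1 D hD).1.1.card_pos
          (Finset.card_le_card (hF.1 D hD).2)
    _ = ((∑ D ∈ F, D.card : ℕ) : ℝ) * (1 + Real.log A.card / Real.log 2) := by
        rw [Nat.cast_sum, Finset.sum_mul]
    _ ≤ splitPotential A.card :=
        mul_le_mul_of_nonneg_right (by exact_mod_cast hF.sum_card_le) (one_add_log_nonneg _)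

end SplitPotential

/-! ### Variant, invariant and potential of the main loop -/

theorem card_pos_of_split {V : Type u} [DecidableEq V] {S C : Finset V} (hC : C ⊆ S)
    (hne : C.Nonempty) (hCS : C ≠ S) :
    0 < C.card ∧ 0 < (S \ C).card ∧ C.card + (S \ C).card = S.card := by
  refine ⟨hne.card_pos, Finset.card_pos.2 ?_,
    by rw [add_comm, Finset.card_sdiff_add_card_eq_card hC]⟩
  rw [Finset.sdiff_nonempty]
  exact fun h => hCS (hC.antisymm h)

theorem sum_image_candidates {V : Type u} [DecidableEq V] (F : Finset (Finset V)) {M : Type*}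
    [AddCommMonoid M] (f : Finset V × Finset V × Finset V → M) :
    ∑ c ∈ F.image (fun C => ((C, ∅, ∅) : Finset V × Finset V × Finset V)), f c =
      ∑ C ∈ F, f (C, ∅, ∅) :=
  Finset.sum_image fun _ _ _ _ h => (Prod.ext_iff.1 h).1

/-- A split into `|F| ≥ 2` parts thus brings the sum of the variants `2|D| - 1` strictly below `2|S|
- 1`. -/
theorem IsSCCs.sum_variant_le {V : Type u} [DecidableEq V] {G : Digraph V} {S : Finset V}
    {F : Finset (Finset V)} (hF : IsSCCs G S F) :
    ∑ D ∈ F, (2 * D.card - 1) + F.card ≤ 2 * S.card := by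
  have h := hF.sum_card_le
  have : ∑ D ∈ F, (2 * D.card - 1) + F.card = 2 * ∑ D ∈ F, D.card := by
    rw [Finset.card_eq_sum_ones, ← Finset.sum_add_distrib, Finset.mul_sum]
    refine Finset.sum_congr rfl fun D hD => ?_
    have := (hF.1 D hD).1.1.card_pos
    omega
  omega

section MainLoop

variable {V : Type u} [Fintype V] [DecidableEq V] {G : Digraph V} [DecidableRel G.Adj]
  {k : ℕ} {L U : Fin k → Finset V} {thr β B : ℝ}

/-- The potential of a candidate: an upper bound for the steps it is yet to cause. -/
noncomputable def candPotential (G : Digraph V) [DecidableRel G.Adj] (thr β : ℝ)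
    (c : Finset V × Finset V × Finset V) : ℝ :=
  3 * ((2 * c.1.card - 1 : ℕ) : ℝ) + β * candWeight G c + thr * splitPotential c.1.card

theorem candPotential_nonneg (hthr : 0 ≤ thr) (hβ : 0 ≤ β)
    (c : Finset V × Finset V × Finset V) : 0 ≤ candPotential G thr β c := by
  have := splitPotential_nonneg c.1.card
  unfold candPotential
  positivity

theorem Finset.sum_union_le {ι : Type*} [DecidableEq ι] (s t : Finset ι) {f : ι → ℝ}
    (hf : ∀ i, 0 ≤ f i) : ∑ i ∈ s ∪ t, f i ≤ ∑ i ∈ s, f i + ∑ i ∈ t, f i := by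
  rw [← Finset.sum_union_inter]
  exact le_add_of_nonneg_right (Finset.sum_nonneg fun i _ => hf i)

/-- The invariant of the main loop, with the set `X` of candidates, the set `good` of components
that have been found, the number `t` of steps so far, and the variant `d`. -/
def MainInv (G : Digraph V) [DecidableRel G.Adj] (L U : Fin k → Finset V) (thr β B : ℝ)
    (d : ℕ) (st : Finset (Finset V × Finset V × Finset V) × Finset (Finset V)) (t : ℕ) : Prop :=
  d = ∑ c ∈ st.1, (2 * c.1.card - 1) ∧
  (∀ c ∈ st.1, c.1.Nonempty ∧ IsCandidate G c.1 c.2.1 c.2.2) ∧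
  (∀ S ∈ st.2, IsGoodComp G L U S) ∧
  (∀ I, IsGoodComp G L U I → (∃ c ∈ st.1, I ⊆ c.1) ∨ ∃ S ∈ st.2, I ⊆ S) ∧
  (6 * Fintype.card V ≤ β * thr → t + ∑ c ∈ st.1, candPotential G thr β c ≤ B)

/-- The common form of all branches: `c` is replaced by the candidates `Y`, to which its good
components are handed on unless already found, and the released potential pays for the `t'` steps.
-/
theorem MainInv.step {d t t' : ℕ} {X Y : Finset (Finset V × Finset V × Finset V)}
    {good good' : Finset (Finset V)} {c : Finset V × Finset V × Finset V}
    (hthr : 0 ≤ thr) (hβ : 0 ≤ β)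
    (h : MainInv G L U thr β B d (X, good) t) (hc : c ∈ X)
    (hY : ∀ c ∈ Y, c.1.Nonempty ∧ IsCandidate G c.1 c.2.1 c.2.2)
    (hd : ∑ c ∈ Y, (2 * c.1.card - 1) < 2 * c.1.card - 1)
    (hsub : good ⊆ good') (hgood : ∀ S ∈ good', IsGoodComp G L U S)
    (hcov : ∀ I ⊆ c.1, IsGoodComp G L U I → (∃ c ∈ Y, I ⊆ c.1) ∨ ∃ S ∈ good', I ⊆ S)
    (ht : 6 * Fintype.card V ≤ β * thr →
      t' + ∑ c ∈ Y, candPotential G thr β c ≤ candPotential G thr β c) :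
    ∃ d' < d, MainInv G L U thr β B d' (X.erase c ∪ Y, good') (t + t') := by
  obtain ⟨h1, h2, h3, h4, h5⟩ := h
  dsimp only at h1 h2 h3 h4 h5
  refine ⟨_, ?_, rfl, ?_, hgood, ?_, ?_⟩
  -- The union need not be disjoint; coinciding candidates only lower the sum.
  · have e1 := Finset.sum_union_inter (s₁ := X.erase c) (s₂ := Y)
      (f := fun c : Finset V × Finset V × Finset V => 2 * c.1.card - 1)
    have e2 := Finset.sum_erase_add X (fun c => 2 * c.1.card - 1) hc
    dsimp only at e1 e2 ⊢
    omega
  · intro c' hc'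
    rcases Finset.mem_union.1 hc' with hc' | hc'
    exacts [h2 c' (Finset.mem_of_mem_erase hc'), hY c' hc']
  · intro I hI
    rcases h4 I hI with ⟨c', hc', hIc⟩ | ⟨S, hS, hIS⟩
    · by_cases hcc : c' = c
      · subst hcc
        rcases hcov I hIc hI with ⟨c', hc', hIc⟩ | h
        exacts [Or.inl ⟨c', Finset.mem_union_right _ hc', hIc⟩, Or.inr h]
      · exact Or.inl ⟨c', Finset.mem_union_left _ (Finset.mem_erase.2 ⟨hcc, hc'⟩), hIc⟩
    · exact Or.inr ⟨S, hsub hS, hIS⟩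
  · intro hβt
    have e1 := Finset.sum_union_le (X.erase c) Y (candPotential_nonneg (G := G) hthr hβ)
    have e2 := Finset.sum_erase_add X (candPotential G thr β) hc
    have e3 := ht hβt
    have e4 := h5 hβt
    push_cast
    linarith

/-- The step that ends with a candidate being discarded or found to be good. -/
theorem MainInv.remove {d t t' : ℕ} {X : Finset (Finset V × Finset V × Finset V)}
    {good good' : Finset (Finset V)} {c : Finset V × Finset V × Finset V}
    (hthr : 0 ≤ thr) (hβ : 0 ≤ β)
    (h : MainInv G L U thr β B d (X, good) t) (hc : c ∈ X)
    (hsub : good ⊆ good') (hgood : ∀ S ∈ good', IsGoodComp G L U S)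
    (hcov : ∀ I ⊆ c.1, IsGoodComp G L U I → ∃ S ∈ good', I ⊆ S)
    (ht : 6 * Fintype.card V ≤ β * thr → (t' : ℝ) ≤ candPotential G thr β c) :
    ∃ d' < d, MainInv G L U thr β B d' (X.erase c, good') (t + t') := by
  have := MainInv.step (Y := ∅) (good' := good') (t' := t') hthr hβ h hc (by simp) ?_ hsub hgood
    (fun I hI hIg => Or.inr (hcov I hI hIg)) (by simpa using ht)
  · simpa using this
  · have := (h.2.1 c hc).1.card_pos
    simp only [Finset.sum_empty]
    omega

theorem IsSCCs.sum_candPotential_le (hthr : 0 ≤ thr) (hβ : 0 ≤ β) {S : Finset V}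
    {F : Finset (Finset V)} (hF : IsSCCs G S F) :
    ∑ D ∈ F, candPotential G thr β (D, ∅, ∅) + 3 * F.card ≤ 6 * S.card +
      β * (G.edgesBetween S S).card + thr * splitPotential S.card := by
  have e1 : ((∑ D ∈ F, (2 * D.card - 1) + F.card : ℕ) : ℝ) ≤ ((2 * S.card : ℕ) : ℝ) := by
    exact_mod_cast hF.sum_variant_le
  have e2 : ((∑ D ∈ F, (G.edgesBetween D D).card : ℕ) : ℝ) ≤ (G.edgesBetween S S).card := by
    exact_mod_cast hF.sum_edges_le
  have e3 := mul_le_mul_of_nonneg_left hF.sum_splitPotential_le hthr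
  have e4 := mul_le_mul_of_nonneg_left e2 hβ
  simp only [candPotential, candWeight, Finset.card_empty, add_zero, Finset.sum_add_distrib,
    ← Finset.mul_sum]
  push_cast at e1 e4 ⊢
  linarith

end MainLoop

/-- `S` is closed in itself, so under the second alternative `H` would be nonempty. -/
theorem IsCandidate.stronglyConn {V : Type u} {G : Digraph V} {S H T : Finset V}
    (h : IsCandidate G S H T) (hS : S.Nonempty) (h0 : H.card + T.card = 0) :
    StronglyConn G.Adj S := by
  rcases h.2.2 with h | h
  · exact h.1
  · obtain ⟨x, hx, -⟩ := h.1 S ⟨subset_rfl, fun v hv _ _ _ => hv⟩ hS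
    have := Finset.card_pos.2 ⟨x, hx⟩
    omega

/-! ### Cost of each branch, and the algorithm as a whole -/

section Algorithm

variable {V : Type u} [Fintype V] [DecidableEq V] {G : Digraph V} [DecidableRel G.Adj]
  {k : ℕ} {L U : Fin k → Finset V} {thr β : ℝ}

theorem candPotential_removeBad (hthr : 0 ≤ thr) (hβ : 0 ≤ β)
    {c c' : Finset V × Finset V × Finset V} {t : ℕ} (hne : c'.1.Nonempty) (hsub : c'.1 ⊆ c.1)
    (ht : t + 2 * c'.1.card ≤ 2 * c.1.card) (hw : candWeight G c' ≤ candWeight G c) :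
    t + candPotential G thr β c' ≤ candPotential G thr β c := by
  have h1 : t + 3 * (2 * c'.1.card - 1) ≤ 3 * (2 * c.1.card - 1) := by
    have := hne.card_pos
    omega
  have h1' : ((t + 3 * (2 * c'.1.card - 1) : ℕ) : ℝ) ≤ ((3 * (2 * c.1.card - 1) : ℕ) : ℝ) := by
    exact_mod_cast h1
  have hw' : (candWeight G c' : ℝ) ≤ candWeight G c := by exact_mod_cast hw
  have h2 := mul_le_mul_of_nonneg_left hw' hβ
  have h3 := mul_le_mul_of_nonneg_left
    (splitPotential_mono hne.card_pos (Finset.card_le_card hsub)) hthr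
  rw [Nat.cast_add, Nat.cast_mul, Nat.cast_mul] at h1'
  unfold candPotential
  push_cast at h1'
  linarith

theorem add_le_candPotential {c : Finset V × Finset V × Finset V} (hne : c.1.Nonempty) :
    3 + β * candWeight G c + thr * splitPotential c.1.card ≤ candPotential G thr β c := by
  have h1 : 1 ≤ 2 * c.1.card - 1 := by
    have := hne.card_pos
    omega
  have h1' : (1 : ℝ) ≤ ((2 * c.1.card - 1 : ℕ) : ℝ) := by exact_mod_cast h1
  unfold candPotential
  linarith

/-- Dropping `H` and `T` frees at least `β · thr ≥ 6n`, which pays for the component computation;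
having at least two parts frees three more. -/
theorem candPotential_sccs (hthr : 0 ≤ thr) (hβ : 0 ≤ β) {S H T : Finset V}
    {F : Finset (Finset V)} (hF : IsSCCs G S F) (hF2 : 2 ≤ F.card) (hS : S.Nonempty)
    (hbig : thr ≤ H.card + T.card) {t : ℕ} (ht : t ≤ 6 * S.card)
    (hβt : 6 * Fintype.card V ≤ β * thr) :
    t + 3 + ∑ D ∈ F, candPotential G thr β (D, ∅, ∅) ≤ candPotential G thr β (S, H, T) := by
  have h1 := hF.sum_candPotential_le hthr hβ
  have h2 : (2 : ℝ) ≤ F.card := by exact_mod_cast hF2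
  have h3 : (t : ℝ) ≤ 6 * Fintype.card V := by
    exact_mod_cast ht.trans (Nat.mul_le_mul_left 6 S.card_le_univ)
  have h4 := mul_le_mul_of_nonneg_left hbig hβ
  have h5 : ((2 * S.card - 1 : ℕ) : ℝ) = 2 * S.card - 1 := by
    rw [Nat.cast_sub (by have := hS.card_pos; omega)]
    push_cast
    rfl
  have h6 : candPotential G thr β (S, H, T) = 3 * (2 * S.card - 1) +
      β * ((G.edgesBetween S S).card + (H.card + T.card)) + thr * splitPotential S.card := by
    simp only [candPotential, candWeight, h5]
    push_cast
    ring
  linarith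

/-- The search costs at most `thr` per round, covered by `splitPotential_add`. The linear term frees
three, for `Post(S)`, `Post(C)` and `Pre(C)`. -/
theorem candPotential_lockStep (hthr : 0 ≤ thr) (hβ : 0 ≤ β) {S H T H' T' C : Finset V}
    (hC : C ⊆ S) (hne : C.Nonempty) (hCS : C ≠ S) (hH : H' ⊆ H) (hT : T' ⊆ T)
    (hsmall : H.card + T.card ≤ thr) {t ρ : ℕ} (ht : t ≤ ρ * (H.card + T.card))
    (h1 : ρ ≤ C.card) (h2 : ρ ≤ (S \ C).card) :
    t + 3 + (candPotential G thr β (C, ∅, ∅) + candPotential G thr β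
      (S \ C, (H' ∪ G.postSet C) ∩ (S \ C), (T' ∪ G.preSet C) ∩ (S \ C))) ≤
      candPotential G thr β (S, H, T) := by
  obtain ⟨c1, c2, c3⟩ := card_pos_of_split hC hne hCS
  have e1 : (t : ℝ) ≤ thr * ρ := by
    calc (t : ℝ) ≤ ρ * (H.card + T.card) := by exact_mod_cast ht
      _ ≤ ρ * thr := mul_le_mul_of_nonneg_left hsmall (Nat.cast_nonneg ρ)
      _ = thr * ρ := mul_comm _ _
  have e2 := mul_le_mul_of_nonneg_left (splitPotential_add c1 c2 h1 h2) hthr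
  rw [c3] at e2
  have e3 := candWeight_split (G := G) (H := H') (T := T') hC
  have e4 : candWeight G (S, H', T') ≤ candWeight G (S, H, T) := by
    have := Finset.card_le_card hH
    have := Finset.card_le_card hT
    simp only [candWeight]
    omega
  have e5 := mul_le_mul_of_nonneg_left
    ((Nat.cast_le (α := ℝ)).2 (e3.trans e4)) hβ
  have e6 : 3 * (2 * C.card - 1) + 3 * (2 * (S \ C).card - 1) + 3 = 3 * (2 * S.card - 1) := by
    omega
  have e7 := congrArg (Nat.cast (R := ℝ)) e6
  rw [Nat.cast_add, Nat.cast_add, Nat.cast_mul, Nat.cast_mul, Nat.cast_mul] at e7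
  rw [Nat.cast_add] at e5
  unfold candPotential
  dsimp only at e5 ⊢
  push_cast at e7
  linarith

/-- Correctness of Algorithm StreettGraphImpr, and a bound for its symbolic steps in terms of a
parameter `β`, the price of an edge. -/
theorem sat_streettGraphImpr (hβ : 0 ≤ β) (m : ℕ) :
    Sat G (streettGraphImpr m L U) fun W t =>
      (W : Set V) = winningSet (streettObjective G L U) ∧
      (6 * Fintype.card V ≤ β * √((m : ℝ) / Real.log (Fintype.card V)) →
        (t : ℝ) ≤ 13 * Fintype.card V + 1 + β * G.numEdges +
          √((m : ℝ) / Real.log (Fintype.card V)) * splitPotential (Fintype.card V)) := by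
  obtain ⟨thr, hthr⟩ : ∃ thr, thr = √((m : ℝ) / Real.log (Fintype.card V)) := ⟨_, rfl⟩
  have hthr0 : 0 ≤ thr := hthr ▸ Real.sqrt_nonneg _
  rw [← hthr]
  unfold streettGraphImpr
  rw [← hthr]
  refine sat_bind ((sat_allSCCs Finset.univ).mono ?_)
  rintro init t₀ ⟨hinit, ht₀⟩
  refine sat_bind (Sat.mono (Q := fun good t => (∀ S ∈ good, IsGoodComp G L U S) ∧
    (∀ I, IsGoodComp G L U I → ∃ S ∈ good, I ⊆ S) ∧ (6 * Fintype.card V ≤ β * thr →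
      (t : ℝ) ≤ ∑ D ∈ init, candPotential G thr β (D, ∅, ∅))) ?_ ?_)
  · refine sat_loop (MainInv G L U thr β (∑ D ∈ init, candPotential G thr β (D, ∅, ∅))) _
      ⟨rfl, ?_, ?_, ?_, ?_⟩ ?_
    · intro c hc
      obtain ⟨D, hD, rfl⟩ := Finset.mem_image.1 hc
      exact ⟨(hinit.1 D hD).1.1, (hinit.1 D hD).1.isCandidate⟩
    · simp
    · intro I hI
      obtain ⟨D, hD, hID⟩ := hinit.2.2 I (Finset.subset_univ I) hI.1
      exact Or.inl ⟨_, Finset.mem_image_of_mem _ hD, hID⟩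
    · intro _
      rw [sum_image_candidates]
      simp
    rintro d ⟨X, good⟩ t hI
    dsimp only
    by_cases hX : X = ∅
    · rw [if_pos hX]
      subst hX
      refine sat_pure ⟨hI.2.2.1, fun I hIg => ?_, fun hβt => ?_⟩
      · simpa using hI.2.2.2.1 I hIg
      · simpa using hI.2.2.2.2 hβt
    rw [if_neg hX]
    refine sat_bind (sat_choose (Finset.nonempty_iff_ne_empty.2 hX) fun c hc => ?_)
    obtain ⟨hcne, hcand⟩ := hI.2.1 c hc
    refine sat_bind ((sat_removeBad L U hcand).mono ?_)
    rintro ⟨S, H, T⟩ t₁ ⟨hST, hSc, ht₁, hw, hbad, hkeep⟩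
    dsimp only at hST hSc ht₁ hbad hkeep ⊢
    refine sat_bind (sat_post ?_)
    simp only [zero_add]
    -- `S` may be empty here, so the linear term of the original candidate `c` has to pay.
    have hdone : ∀ t', t' ≤ t₁ + 1 → (t' : ℝ) ≤ candPotential G thr β c := by
      intro t' ht'
      have hpos := hcne.card_pos
      have h1 : t' ≤ 3 * (2 * c.1.card - 1) := by omega
      have h2 := mul_nonneg hthr0 (splitPotential_nonneg c.1.card)
      have h3 := mul_nonneg hβ (Nat.cast_nonneg (α := ℝ) (candWeight G c))
      have h4 : (t' : ℝ) ≤ ((3 * (2 * c.1.card - 1) : ℕ) : ℝ) := by exact_mod_cast h1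
      rw [Nat.cast_mul] at h4
      unfold candPotential
      push_cast at h4
      linarith
    by_cases hP : G.postSet S ∩ S = ∅
    · rw [if_pos hP]
      refine sat_pure (hI.remove hthr0 hβ hc subset_rfl hI.2.2.1 (fun I hIc hIg => ?_)
        fun _ => hdone _ (by omega))
      have hIS := hkeep I hIc hIg
      refine absurd (Finset.subset_empty.1 (hP ▸ fun x hx => ?_)) hIg.2.1
      rw [Finset.mem_inter, mem_postSet] at hx ⊢
      obtain ⟨⟨w, hw, hwx⟩, hxI⟩ := hx
      exact ⟨⟨w, hIS hw, hwx⟩, hIS hxI⟩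
    rw [if_neg hP]
    have hSne : S.Nonempty :=
      (Finset.nonempty_iff_ne_empty.2 hP).mono Finset.inter_subset_right
    have hfound : StronglyConn G.Adj S → ∀ t' : ℕ,
        (6 * Fintype.card V ≤ β * thr → (t' : ℝ) ≤ candPotential G thr β c) →
        ∃ d' < d, MainInv G L U thr β (∑ D ∈ init, candPotential G thr β (D, ∅, ∅)) d'
          (X.erase c, insert S good) (t + t') := by
      intro hS t' ht'
      refine hI.remove hthr0 hβ hc (Finset.subset_insert S good) (fun S' hS' => ?_)
        (fun I hIc hIg => ⟨S, Finset.mem_insert_self S good, hkeep I hIc hIg⟩) ht'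
      rcases Finset.mem_insert.1 hS' with rfl | hS'
      exacts [⟨hS, hP, hbad⟩, hI.2.2.1 S' hS']
    have hpot := candPotential_removeBad (G := G) (β := β) hthr0 hβ (c := c) (c' := (S, H, T))
      hSne hSc ht₁ hw
    have hpot3 := add_le_candPotential (G := G) (thr := thr) (β := β) (c := (S, H, T)) hSne
    by_cases h0 : H.card + T.card = 0
    · rw [if_pos h0]
      exact sat_pure (hfound (hST.stronglyConn hSne h0) _ fun _ => hdone _ (by omega))
    rw [if_neg h0]
    by_cases hbig : thr ≤ (H.card : ℝ) + (T.card : ℝ)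
    · rw [if_pos hbig]
      refine sat_bind ((sat_allSCCs S).mono ?_)
      rintro sccs t₂ ⟨hsccs, ht₂⟩
      split_ifs with h1
      · refine sat_pure (hfound (hsccs.eq_of_card_eq_one h1) _ fun hβt => ?_)
        have e1 : (t₂ : ℝ) ≤ 6 * Fintype.card V := by
          exact_mod_cast ht₂.trans (Nat.mul_le_mul_left 6 S.card_le_univ)
        have e2 := mul_le_mul_of_nonneg_left hbig hβ
        have e3 := mul_nonneg hthr0 (splitPotential_nonneg S.card)
        have e4 := mul_nonneg hβ (Nat.cast_nonneg (α := ℝ) (G.edgesBetween S S).card)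
        simp only [candWeight] at hpot3
        push_cast at hpot3 ⊢
        linarith
      · have h2 : 2 ≤ sccs.card := by
          have := (hsccs.nonempty hSne).card_pos
          omega
        refine sat_pure (hI.step hthr0 hβ hc ?_ ?_ subset_rfl hI.2.2.1 ?_ ?_)
        · intro c' hc'
          obtain ⟨D, hD, rfl⟩ := Finset.mem_image.1 hc'
          exact ⟨(hsccs.1 D hD).1.1, (hsccs.1 D hD).1.isCandidate⟩
        · rw [sum_image_candidates]
          have := hsccs.sum_variant_le
          have := Finset.card_le_card hSc
          dsimp only
          omega
        · intro I hIc hIg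
          obtain ⟨D, hD, hID⟩ := hsccs.2.2 I (hkeep I hIc hIg) hIg.1
          exact Or.inl ⟨_, Finset.mem_image_of_mem _ hD, hID⟩
        · intro hβt
          rw [sum_image_candidates]
          have := candPotential_sccs hthr0 hβ hsccs h2 hSne hbig ht₂ hβt
          push_cast
          linarith
    rw [if_neg hbig]
    have hsmall := (not_le.1 hbig).le
    have hmeets : Meets G.Adj S H ∧ Meets (flip G.Adj) S T := by
      rcases hST.2.2 with h | h
      · simp [h.2.1, h.2.2] at h0
      · exact h
    refine sat_bind ((sat_lockStepSearch hSne hST.1 hST.2.1 hmeets.1 hmeets.2).mono ?_)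
    rintro ⟨C, H', T'⟩ t₂ ⟨hcl, hCs, hH', hT', hmH', hmT', ρ, ht₂, hρ, hρ'⟩
    dsimp only at hcl hCs hH' hT' hmH' hmT' ht₂ hρ hρ' ⊢
    split_ifs with hCS
    · subst hCS
      refine sat_pure (hfound hCs _ fun _ => ?_)
      -- Nothing is split, so `ρ` is bounded only by `|S|`; but the candidate disappears and its
      -- whole potential is available.
      have e1 : (t₂ : ℝ) ≤ thr * splitPotential C.card := by
        calc (t₂ : ℝ) ≤ ρ * (H.card + T.card) := by exact_mod_cast ht₂
          _ ≤ ρ * thr := mul_le_mul_of_nonneg_left hsmall (Nat.cast_nonneg ρ)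
          _ ≤ splitPotential C.card * thr := mul_le_mul_of_nonneg_right
              ((Nat.cast_le.2 hρ).trans (le_splitPotential _)) hthr0
          _ = thr * splitPotential C.card := mul_comm _ _
      have e2 := mul_nonneg hβ (Nat.cast_nonneg (α := ℝ) (candWeight G (C, H, T)))
      push_cast
      dsimp only at hpot3
      linarith
    · have hCsub : C ⊆ S := hcl.elim And.left And.left
      refine sat_bind (sat_post (sat_bind (sat_pre (sat_pure ?_))))
      simp only [Sum.elim_inl, Finset.union_assoc]
      obtain ⟨c1, c2, c3⟩ := card_pos_of_split hCsub hCs.1 hCS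
      have hne : ((S \ C, (H' ∪ G.postSet C) ∩ (S \ C), (T' ∪ G.preSet C) ∩ (S \ C)) :
          Finset V × Finset V × Finset V) ∉ ({(C, ∅, ∅)} : Finset _) := by
        rw [Finset.mem_singleton, Prod.ext_iff]
        rintro ⟨he, -⟩
        obtain ⟨x, hx⟩ := hCs.1
        exact (Finset.mem_sdiff.1 ((show S \ C = C from he).symm ▸ hx)).2 hx
      refine hI.step hthr0 hβ hc ?_ ?_ subset_rfl hI.2.2.1 ?_ ?_
      · intro c' hc'
        rw [Finset.mem_union, Finset.mem_singleton, Finset.mem_singleton] at hc'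
        rcases hc' with rfl | rfl
        · exact ⟨Finset.card_pos.1 c2,
            IsCandidate.sdiff (Or.inr ⟨hmH', hmT'⟩) hCsub hCs.1⟩
        · exact ⟨hCs.1, hCs.isCandidate⟩
      · rw [← Finset.insert_eq, Finset.sum_insert hne, Finset.sum_singleton]
        have := Finset.card_le_card hSc
        dsimp only
        omega
      · intro I hIc hIg
        have hIS := hkeep I hIc hIg
        have hcase : I ⊆ C ∨ I ⊆ S \ C := hcl.elim (hIg.1.subset_or_disjoint hIS)
          (hIg.1.flip.subset_or_disjoint hIS)
        rcases hcase with h | h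
        · exact Or.inl ⟨(C, ∅, ∅), by simp, h⟩
        · exact Or.inl ⟨_, Finset.mem_union_left _ (Finset.mem_singleton_self _), h⟩
      · intro _
        rw [← Finset.insert_eq, Finset.sum_insert hne, Finset.sum_singleton]
        have := candPotential_lockStep (G := G) hthr0 hβ hCsub hCs.1 hCS hH' hT' hsmall ht₂ hρ
          (hρ' hCS)
        push_cast
        linarith
  · rintro good t₁ ⟨hgood, hcov, ht₁⟩
    refine (sat_symReach _).mono ?_
    rintro W t₂ ⟨hW, ht₂⟩
    refine ⟨hW.eq_winningSet hgood hcov, fun hβt => ?_⟩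
    have e1 := ht₁ hβt
    have e2 := hinit.sum_candPotential_le hthr0 hβ
    rw [edgesBetween_univ, Finset.card_univ] at e2
    rw [Finset.card_univ] at ht₀
    have e3 : (t₀ : ℝ) ≤ 6 * Fintype.card V := by exact_mod_cast ht₀
    have e4 : (t₂ : ℝ) ≤ Fintype.card V + 1 := by exact_mod_cast ht₂
    have e5 : (0 : ℝ) ≤ init.card := Nat.cast_nonneg _
    push_cast
    linarith

end Algorithm

/-- The witness is the least admissible price `β = 6n / √(m / log n)`. With `q = n√(m log n)` and
`√(m log n) ≥ 1/2`, the summands are at most `26q`, `q`, `6q` and `4q`. -/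
theorem steps_bound {n m : ℕ} (hn : 2 ≤ n) (hm : 1 ≤ m) :
    ∃ β : ℝ, 0 ≤ β ∧ 6 * n ≤ β * √((m : ℝ) / Real.log n) ∧
      13 * n + 1 + β * m + √((m : ℝ) / Real.log n) * splitPotential n ≤
        40 * (n * √((m : ℝ) * Real.log n)) := by
  have hm' : (1 : ℝ) ≤ m := by exact_mod_cast hm
  have hn' : (2 : ℝ) ≤ n := by exact_mod_cast hn
  have hl2 : (1 : ℝ) / 2 ≤ Real.log 2 := by linarith [Real.log_two_gt_d9]
  have hl : Real.log 2 ≤ Real.log n := Real.log_le_log two_pos hn'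
  have hl0 : 0 < Real.log n := by linarith
  set l := Real.log n
  have hd : 0 < √((m : ℝ) / l) := Real.sqrt_pos.2 (by positivity)
  have hq : √((m : ℝ) * l) = √((m : ℝ) / l) * l := by
    rw [show (m : ℝ) * l = (m / l) * l ^ 2 by field_simp, Real.sqrt_mul (by positivity),
      Real.sqrt_sq hl0.le]
  have hsq : √((m : ℝ) / l) * √((m : ℝ) / l) = m / l := Real.mul_self_sqrt (by positivity)
  have hQ : 1 / 2 ≤ √((m : ℝ) * l) := by
    refine Real.le_sqrt_of_sq_le ?_
    nlinarith
  refine ⟨6 * n / √((m : ℝ) / l), by positivity, (div_mul_cancel₀ _ hd.ne').ge, ?_⟩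
  have e1 : 6 * n / √((m : ℝ) / l) * m = 6 * (n * √((m : ℝ) * l)) := by
    rw [div_mul_eq_mul_div, div_eq_iff hd.ne', hq]
    rw [show 6 * (n * (√((m : ℝ) / l) * l)) * √((m : ℝ) / l) =
      6 * n * ((√((m : ℝ) / l) * √((m : ℝ) / l)) * l) by ring, hsq, div_mul_cancel₀ _ hl0.ne']
  have e2 : √((m : ℝ) / l) * splitPotential n ≤ 4 * (n * √((m : ℝ) * l)) := by
    have : splitPotential n ≤ n * (4 * l) := by
      refine mul_le_mul_of_nonneg_left ?_ (Nat.cast_nonneg n)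
      have : l / Real.log 2 ≤ 2 * l := by
        rw [div_le_iff₀ (by linarith)]
        nlinarith
      linarith
    calc √((m : ℝ) / l) * splitPotential n ≤ √((m : ℝ) / l) * (n * (4 * l)) :=
          mul_le_mul_of_nonneg_left this hd.le
      _ = 4 * (n * √((m : ℝ) * l)) := by rw [hq]; ring
  have e3 : (n : ℝ) * (1 / 2) ≤ n * √((m : ℝ) * l) :=
    mul_le_mul_of_nonneg_left hQ (Nat.cast_nonneg n)
  rw [e1]
  linarith

theorem theorem2 :
    ∃ c : ℝ, 0 < c ∧
      ∀ (V : Type u) [Fintype V] [DecidableEq V] (G : Digraph V) [DecidableRel G.Adj]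
        (k : ℕ) (L U : Fin k → Finset V),
        (streettGraphImpr G.numEdges L U).Halts G ∧
        ∀ (W : Finset V) (t : ℕ), (streettGraphImpr G.numEdges L U).Exec G W t →
          (W : Set V) = winningSet (streettObjective G L U) ∧
          (2 ≤ Fintype.card V → 1 ≤ G.numEdges →
            (t : ℝ) ≤ c * ((Fintype.card V : ℝ) *
              √((G.numEdges : ℝ) * Real.log (Fintype.card V)))) := by
  refine ⟨40, by norm_num, fun V _ _ G _ k L U => ?_⟩
  -- Here `le_rfl` sets `β = 0`: termination and correctness need no price, while `steps_bound`
  -- supplies one only for `n ≥ 2` and `m ≥ 1`.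
  have h := sat_streettGraphImpr (G := G) (L := L) (U := U) le_rfl G.numEdges
  refine ⟨h.1, fun W t e => ⟨(h.2 W t e).1, fun hn hm => ?_⟩⟩
  obtain ⟨β, hβ, h1, h2⟩ := steps_bound hn hm
  exact (((sat_streettGraphImpr hβ G.numEdges).2 W t e).2 h1).trans h2
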